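/- **Problem.** Let $\mathcal Q(x)=c^Tx+\sum_{i=1}^N p_i\mathcal Q_i(x)$ on $\mathbb R^n$, where $p_i\ge 0$, $\sum_i p_i=1$ and $\mathcal Q_i(x)=\min\{q_i^Ty : Wy=h_i-T_ix,\ y\ge 0\}$. Assume that for every $i$ and every $x$ this second-stage linear program is feasible and has a finite value, and that the set $\mathcal S$ of minimizers of $\mathcal Q$ over $X=\{x: Ax=b,\ x\ge 0\}$ is nonempty. The scenarios are divided into clusters $\mathcal N_1,\dots,\mathcal N_T$, and $\mathcal Q_{[j]}=\sum_{i\in\mathcal N_j}p_i\mathcal Q_i$. **Models.** A *cut* for cluster $j$ is an affine function $x\mapsto g^Tx+f$. A finite set of cuts defines the model $m(x)=c^Tx+\sum_j m_{[j]}(x)$, where $m_{[j]}(x)$ is the maximum of the cuts for cluster $j$ at $x$ ($-\infty$ if there are none). The subproblem $\mathrm{trsub}(z,\Delta)$ is to minimize $m(x)$ over $x\in X$, $\|x-z\|_\infty\le\Delta$. **Algorithm ATR.** Parameters: $\xi\in(0,\frac12)$, $\eta\in[0,1)$, $\Delta_{\rm hi}>0$, $\sigma\in(0,1]$, an integer $K>0$,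 $\epsilon_{\rm tol}\ge 0$. Start with $x^0\in X$, incumbent index $I=-1$ (dummy; $x^{-1}=x^0$, $\mathcal Q^{-1}=\infty$), $I_0=-1$, $k=0$, $\Delta_{\rm curr}\in(0,\Delta_{\rm hi}]$, $\mathtt{counter}=0$, empty basket $\mathcal B$, a finite (possibly empty) initial set of cuts, each cut for cluster $j$ being $\le\mathcal Q_{[j]}$, and the $T$ tasks $(0,1),\dots,(0,T)$ issued. Task $(q,j)$ computes $\mathcal Q_{[j]}(x^q)$ and some $g_j\in\partial\mathcal Q_{[j]}(x^q)$. Issued tasks are completed in an arbitrary order, one at a time. For $I\ne-1$ write $\mathcal Q^I=\mathcal Q(x^I)$. When task $(q,j)$ is completed, the cut $x\mapsto\mathcal Q_{[j]}(x^q)+g_j^T(x-x^q)$, said to be generated at $q$, is added to the model. Then: 1. If all $T$ tasks of $x^q$ are now complete: if $\mathcal Q(x^q)<\mathcal Q^I$ and ($I_q=-1$ or $\mathcal Q(x^q)\le\mathcal Q^{I_q}-\xi(\mathcal Q^{I_q}-m^q)$), then set $I\leftarrow q$; if moreover $\mathcal Q(x^q)\le\mathcal Q^{I_q}-\frac12(\mathcal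 Q^{I_q}-m^q)$ and $\|x^q-x^{I_q}\|_\infty=\Delta_q$, set $\Delta_{\rm curr}\leftarrow\max(\Delta_{\rm curr},\min(\Delta_{\rm hi},2\Delta_q))$ (when $I_q=-1$ the first of these two conditions may be regarded as true or as false, and $\Delta_0$ is the initial radius); any cuts not generated at $q$ may be deleted. Otherwise, any cuts may be deleted except those generated at $I_k$, those active at the solution $x^k$ of its subproblem, and those generated at an $\ell$ with $I_\ell=I_k\ne-1$ and $\mathcal Q^{I_k}-m^k>\eta(\mathcal Q^{I_k}-m^\ell)$; and, if $I_q\neq-1$, with $\rho=\min(1,\Delta_q)\frac{\mathcal Q(x^q)-\mathcal Q^{I_q}}{\mathcal Q^{I_q}-m^q}$, increase $\mathtt{counter}$ by $1$ if $\rho>0$, and then, if $\rho>3$, or $\mathtt{counter}\ge3$ and $1<\rho\le3$, set $\Delta_{\rm curr}\leftarrow\min(\Delta_{\rm curr},\Delta_q/\min(\rho,4))$ and $\mathtt{counter}\leftarrow0$. In both cases remove $q$ from $\mathcal B$ and go to 3. 2. Otherwise, if at least $\sigma T$ tasks of $x^q$ are complete, $|\mathcal B|<K$, and $x^q$ has not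 yet triggered a new iterate in this step, go to 3. If not, wait for the next completed task. 3. Set $k\leftarrow k+1$, $\Delta_k=\Delta_{\rm curr}$, $I_k=I$; let $x^k$ be a solution of $\mathrm{trsub}(x^I,\Delta_k)$ with the current model and $m^k=m(x^k)$, which is assumed to be finite when $I\ne-1$. If $I\ne -1$ and $\mathcal Q^I-m^k\le\epsilon_{\rm tol}(1+|\mathcal Q^I|)$, STOP. Otherwise put $k$ into $\mathcal B$, issue the tasks $(k,1),\dots,(k,T)$, and wait for the next completed task. **Theorem.** Consider any run of Algorithm ATR with $\epsilon_{\rm tol}=0$ in which every issued task is completed after a finite time (that is, after finitely many task completions, unless the algorithm stops before). (i) If at some moment the incumbent satisfies $x^I\notin\mathcal S$, then this incumbent is replaced by a new incumbent after a finite time. (ii) If at some moment $I\ne-1$ and $x^I\in\mathcal S$, then either the algorithm terminates with this incumbent and verifies its optimality, the last model being an underestimate of $\mathcal Q$ that is $\ge\mathcal Q^I$ on $\{x\in X:\|x-x^I\|_\infty\le\Delta_k\}$ with $\Delta_k>0$; or infinitely many iterates are generated, from the current iterate on all of them have $I_k=I$, and $\mathcal Q^I-m^k$ decreases monotonically to $0$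 as $k\to\infty$. Whenever the algorithm terminates, its incumbent lies in $\mathcal S$. -/

import Mathlib

open scoped Matrix

namespace ATR

noncomputable section

/-! ### The two-stage stochastic linear program -/

/-- Data of a two-stage stochastic linear program with fixed recourse: `n` first-stage variables,
`m₁` first-stage constraints, `n₂` second-stage variables, `m₂` second-stage constraints, `N`
scenarios, grouped into `T` clusters. The norm of `Fin n → ℝ` is the `ℓ∞` norm. -/
structure TwoStageLP (n m₁ n₂ m₂ N T : ℕ) where
  A : Matrix (Fin m₁) (Fin n) ℝ
  b : Fin m₁ → ℝ
  c : Fin n → ℝ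
  /-- scenario probabilities -/
  p : Fin N → ℝ
  /-- second-stage costs `q(ω_i)` -/
  cost : Fin N → Fin n₂ → ℝ
  /-- recourse matrix -/
  W : Matrix (Fin m₂) (Fin n₂) ℝ
  /-- technology matrices `T(ω_i)` -/
  tech : Fin N → Matrix (Fin m₂) (Fin n) ℝ
  h : Fin N → Fin m₂ → ℝ
  /-- the cluster that contains scenario `i` -/
  cluster : Fin N → Fin T

variable {n m₁ n₂ m₂ N T : ℕ}

namespace TwoStageLP

variable (P : TwoStageLP n m₁ n₂ m₂ N T)

/-- First-stage feasible set `{x | A x = b, x ≥ 0}`. -/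
def feasible : Set (Fin n → ℝ) := {x | P.A *ᵥ x = P.b ∧ 0 ≤ x}

/-- Feasible set of the second-stage problem of scenario `i` at `x`. -/
def recourse (i : Fin N) (x : Fin n → ℝ) : Set (Fin n₂ → ℝ) :=
  {y | P.W *ᵥ y = P.h i - P.tech i *ᵥ x ∧ 0 ≤ y}

/-- Objective values of the second-stage problem of scenario `i` at `x`. -/
def recourseValues (i : Fin N) (x : Fin n → ℝ) : Set ℝ :=
  (fun y => P.cost i ⬝ᵥ y) '' P.recourse i x

/-- Optimal value `Q_i(x)` of the second-stage problem. -/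
def Qscen (i : Fin N) (x : Fin n → ℝ) : ℝ := sInf (P.recourseValues i x)

/-- Partial sum `Q_[j](x)` over the scenarios of cluster `j`. -/
def Qclus (j : Fin T) (x : Fin n → ℝ) : ℝ :=
  ∑ i ∈ Finset.univ.filter (fun i => P.cluster i = j), P.p i * P.Qscen i x

/-- The objective `Q(x) = cᵀx + ∑ p_i Q_i(x)`. -/
def Q (x : Fin n → ℝ) : ℝ := P.c ⬝ᵥ x + ∑ i, P.p i * P.Qscen i x

/-- The solution set `S` of `min Q(x)` subject to `A x = b`, `x ≥ 0`. -/
def solutionSet : Set (Fin n → ℝ) := {x | x ∈ P.feasible ∧ ∀ y ∈ P.feasible, P.Q x ≤ P.Q y}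

/-- Standing assumptions: the `p_i` are probabilities, the recourse is complete and all
second-stage optimal values are finite (so `Q` is finite on the whole space), and there is a
solution. -/
structure Standing : Prop where
  p_nonneg : ∀ i, 0 ≤ P.p i
  p_sum : ∑ i, P.p i = 1
  complete_recourse : ∀ i x, (P.recourse i x).Nonempty
  finite_value : ∀ i x, BddBelow (P.recourseValues i x)
  solvable : P.solutionSet.Nonempty

end TwoStageLP

/-! ### Cuts and models -/

/-- An optimality cut `θ_j ≥ gᵀx + f` for cluster `j`. The origin is the index of the iterate at
which the cut was generated, and `none` for a cut of the initial model. -/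
structure Cut (n T : ℕ) where
  origin : Option ℕ
  cluster : Fin T
  g : Fin n → ℝ
  f : ℝ

/-- Value `gᵀx + f` of the cut at `x`. -/
def Cut.val (C : Cut n T) (x : Fin n → ℝ) : ℝ := C.g ⬝ᵥ x + C.f

/-- `m_[j](x)`: the least `θ_j` that satisfies all the cuts for cluster `j`; it is `-∞` if there
are none. -/
def clusterModel (M : Set (Cut n T)) (j : Fin T) (x : Fin n → ℝ) : EReal :=
  ⨆ C ∈ {C ∈ M | C.cluster = j}, (C.val x : EReal)

/-- The model function `m(x) = cᵀx + ∑_j m_[j](x)` defined by the set of cuts `M`. -/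
def TwoStageLP.model (P : TwoStageLP n m₁ n₂ m₂ N T) (M : Set (Cut n T)) (x : Fin n → ℝ) :
    EReal :=
  ((P.c ⬝ᵥ x : ℝ) : EReal) + ∑ j, clusterModel M j x

/-- Feasible set of the trust-region subproblem with center `z` and radius `Δ`. -/
def TwoStageLP.trustRegion (P : TwoStageLP n m₁ n₂ m₂ N T) (z : Fin n → ℝ) (Δ : ℝ) :
    Set (Fin n → ℝ) :=
  {x | x ∈ P.feasible ∧ ‖x - z‖ ≤ Δ}

/-- `x` solves the subproblem `trsub(z, Δ)` for the model given by `M`. -/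
def TwoStageLP.SolvesTrsub (P : TwoStageLP n m₁ n₂ m₂ N T) (M : Set (Cut n T))
    (z : Fin n → ℝ) (Δ : ℝ) (x : Fin n → ℝ) : Prop :=
  x ∈ P.trustRegion z Δ ∧ ∀ y ∈ P.trustRegion z Δ, P.model M x ≤ P.model M y

/-- `g` is a subgradient of `F` at `z`. -/
def IsSubgradient (F : (Fin n → ℝ) → ℝ) (z g : Fin n → ℝ) : Prop :=
  ∀ x, F z + g ⬝ᵥ (x - z) ≤ F x

/-! ### Algorithm ATR -/

/-- Parameters of the algorithm. -/
structure Params where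
  /-- acceptance parameter -/
  ξ : ℝ
  /-- cut deletion parameter -/
  η : ℝ
  /-- upper bound on the trust-region radius -/
  Δhi : ℝ
  /-- synchronicity parameter -/
  σ : ℝ
  /-- maximum basket size -/
  K : ℕ
  /-- tolerance of the convergence test -/
  εtol : ℝ
  ξ_pos : 0 < ξ
  ξ_lt : ξ < 1 / 2
  η_nonneg : 0 ≤ η
  η_lt : η < 1
  Δhi_pos : 0 < Δhi
  σ_pos : 0 < σ
  σ_le : σ ≤ 1
  K_pos : 0 < K
  εtol_nonneg : 0 ≤ εtol

/-- The quantities that the algorithm attaches, once and for all, to the iterates. An entry is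
meaningful from the moment that the iterate has been generated (for `g q j`: the task `(q, j)`
has been completed). The parent incumbent index `none` stands for the dummy index `-1`. -/
structure History (n T : ℕ) where
  /-- iterates `x^k` -/
  x : ℕ → Fin n → ℝ
  /-- parent incumbents `I_k` -/
  parent : ℕ → Option ℕ
  /-- trust-region radii `Δ_k` -/
  Δ : ℕ → ℝ
  /-- optimal values `m^k` of the subproblems with a parent incumbent other than the dummy -/
  m : ℕ → ℝ
  /-- the set of cuts with which the subproblem for `x^k` was solved -/
  cuts : ℕ → Set (Cut n T)
  /-- partial subgradients `g_j` obtained at `x^q` -/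
  g : ℕ → Fin T → Fin n → ℝ

/-- The current values of the program variables. -/
structure State (n T : ℕ) where
  /-- index of the incumbent, `none` for the dummy index `-1` -/
  inc : Option ℕ
  /-- index of the latest iterate -/
  k : ℕ
  Δcurr : ℝ
  counter : ℕ
  basket : Finset ℕ
  /-- number of clusters evaluated so far at each iterate -/
  t : ℕ → ℕ
  speceval : ℕ → Bool
  /-- tasks `(q, j)` (evaluate cluster `j` at `x^q`) that have been issued and not completed -/
  pool : Set (ℕ × Fin T)
  /-- cuts of the current model -/
  model : Set (Cut n T)
  stopped : Bool

namespace History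

variable (H : History n T)

/-- The incumbent point `x^I`; the dummy point `x^{-1}` is `x^0`. -/
def point : Option ℕ → Fin n → ℝ
  | none => H.x 0
  | some r => H.x r

variable (P : TwoStageLP n m₁ n₂ m₂ N T) (par : Params)

/-- The cut generated by task `(q, j)`. -/
def cut (q : ℕ) (j : Fin T) : Cut n T :=
  ⟨some q, j, H.g q j, P.Qclus j (H.x q) - H.g q j ⬝ᵥ H.x q⟩

/-- The cut `C` was active at the solution `x^k` of its subproblem. -/
def Active (k : ℕ) (C : Cut n T) : Prop :=
  C ∈ H.cuts k ∧ (C.val (H.x k) : EReal) = clusterModel (H.cuts k) C.cluster (H.x k)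

/-- The cuts that Procedure Model-Update`(k)` must not delete. -/
def Protected (k : ℕ) (C : Cut n T) : Prop :=
  (∃ r, H.parent k = some r ∧ C.origin = some r) ∨
  H.Active k C ∨
  (∃ r l, H.parent k = some r ∧ C.origin = some l ∧ H.parent l = some r ∧
    P.Q (H.x r) - H.m k > par.η * (P.Q (H.x r) - H.m l))

/-- Procedure Model-Update`(k)` may turn the set of cuts `M` into `M'`. -/
def ModelUpdate (k : ℕ) (M M' : Set (Cut n T)) : Prop :=
  M' ⊆ M ∧ ∀ C ∈ M, H.Protected P par k C → C ∈ M'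

/-- The ratio `ρ` of Procedure Reduce-Δ`(q)`, where `r = I_q`. -/
def ρ (q r : ℕ) : ℝ :=
  min 1 (H.Δ q) * ((P.Q (H.x q) - P.Q (H.x r)) / (P.Q (H.x r) - H.m q))

open Classical in
/-- Procedure Reduce-Δ`(q)`, acting on the pair `(Δ_curr, counter)`. -/
def reduceΔ (q : ℕ) (Δcurr : ℝ) (counter : ℕ) : ℝ × ℕ :=
  match H.parent q with
  | none => (Δcurr, counter)
  | some r =>
    let ρ := H.ρ P q r
    let counter' := if 0 < ρ then counter + 1 else counter
    if 3 < ρ ∨ (3 ≤ counter' ∧ 1 < ρ ∧ ρ ≤ 3) then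
      (min Δcurr (H.Δ q / min ρ 4), 0)
    else (Δcurr, counter')

/-- The update `Δ → Δ'` of the radius when `x^q` becomes the incumbent. If `I_q = -1`, the test
compares infinite quantities, and both outcomes of its first part are allowed. -/
def IncreaseΔ (q : ℕ) (Δ Δ' : ℝ) : Prop :=
  match H.parent q with
  | none => Δ' = Δ ∨ (‖H.x q - H.x 0‖ = H.Δ q ∧ Δ' = max Δ (min par.Δhi (2 * H.Δ q)))
  | some r =>
    let test := P.Q (H.x q) ≤ P.Q (H.x r) - 0.5 * (P.Q (H.x r) - H.m q) ∧
      ‖H.x q - H.x r‖ = H.Δ q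
    (test → Δ' = max Δ (min par.Δhi (2 * H.Δ q))) ∧ (¬ test → Δ' = Δ)

/-- The test for `x^q` to replace the incumbent with index `inc`. -/
def Accept (inc : Option ℕ) (q : ℕ) : Prop :=
  (∀ r, inc = some r → P.Q (H.x q) < P.Q (H.x r)) ∧
  (∀ r, H.parent q = some r →
    P.Q (H.x q) ≤ P.Q (H.x r) - par.ξ * (P.Q (H.x r) - H.m q))

/-- The convergence test for the latest iterate `x^k`; it fails for the dummy incumbent, whose
value is `∞`. -/
def ConvTest (inc : Option ℕ) (k : ℕ) : Prop :=
  ∃ r, inc = some r ∧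
    P.Q (H.x r) - H.m k ≤ par.εtol * (1 + |P.Q (H.x r)|)

/-- First part of `act_on_completed_task` for the task `(q, j)`: count it and add its cut. -/
def record (q : ℕ) (j : Fin T) (s : State n T) : State n T :=
  { s with
    t := Function.update s.t q (s.t q + 1)
    model := insert (H.cut P q j) s.model
    pool := s.pool \ {(q, j)} }

/-- The evaluation at `x^q` has proceeded far enough to trigger a basket-filling iterate. -/
def FillTest (q : ℕ) (s : State n T) : Prop :=
  s.t q ≠ T ∧ par.σ * T ≤ s.t q ∧ s.basket.card < par.K ∧ s.speceval q = false

/-- Middle part of `act_on_completed_task`, in the cases in which it leads to a new iterate. -/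
inductive Trigger (q : ℕ) (s : State n T) : State n T → Prop
  | accept (M' : Set (Cut n T)) (Δ' : ℝ) (full : s.t q = T)
      (acc : H.Accept P par s.inc q)
      (radius : H.IncreaseΔ P par q s.Δcurr Δ')
      (sub : M' ⊆ s.model)
      (keep : ∀ C ∈ s.model, C.origin = some q → C ∈ M') :
      Trigger q s
        { s with inc := some q, Δcurr := Δ', model := M', basket := s.basket.erase q }
  | reject (M' : Set (Cut n T)) (full : s.t q = T)
      (rej : ¬ H.Accept P par s.inc q)
      (upd : H.ModelUpdate P par s.k s.model M') :
      Trigger q s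
        { s with
          model := M'
          Δcurr := (H.reduceΔ P q s.Δcurr s.counter).1
          counter := (H.reduceΔ P q s.Δcurr s.counter).2
          basket := s.basket.erase q }
  | fill (test : FillTest par q s) :
      Trigger q s { s with speceval := Function.update s.speceval q true }

/-- Last part of `act_on_completed_task`: generate the next iterate, then stop, or put the point
into the basket and issue its tasks. The subproblem has to have a finite optimal value, except
during the startup phase, when some cluster may be without any cut. -/
structure NewIterate (s s' : State n T) : Prop where
  parent_eq : H.parent (s.k + 1) = s.inc
  Δ_eq : H.Δ (s.k + 1) = s.Δcurr
  cuts_eq : H.cuts (s.k + 1) = s.model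
  solves : P.SolvesTrsub s.model (H.point s.inc) s.Δcurr (H.x (s.k + 1))
  m_eq : s.inc ≠ none → (H.m (s.k + 1) : EReal) = P.model s.model (H.x (s.k + 1))
  halts : H.ConvTest P par s.inc (s.k + 1) → s' = { s with k := s.k + 1, stopped := true }
  go_on : ¬ H.ConvTest P par s.inc (s.k + 1) → s' =
    { s with
      k := s.k + 1
      basket := insert (s.k + 1) s.basket
      speceval := Function.update s.speceval (s.k + 1) false
      t := Function.update s.t (s.k + 1) 0
      pool := s.pool ∪ {τ | τ.1 = s.k + 1} }

/-- `act_on_completed_task` for the task `(q, j)` may lead from state `s` to state `s'`. -/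
inductive Act (q : ℕ) (j : Fin T) (s : State n T) : State n T → Prop
  | generate (s₂ s' : State n T) (trig : H.Trigger P par q (H.record P q j s) s₂)
      (new : H.NewIterate P par s₂ s') : Act q j s s'
  | idle (not_full : (H.record P q j s).t q ≠ T)
      (not_fill : ¬ FillTest par q (H.record P q j s)) : Act q j s (H.record P q j s)

/-- The state after the initialization at a feasible starting point. The initial model is any
finite (possibly empty) set of cuts that underestimate the partial sums. -/
structure Init (s : State n T) : Prop where
  start : H.x 0 ∈ P.feasible
  parent_zero : H.parent 0 = none
  Δ_zero : H.Δ 0 = s.Δcurr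
  inc : s.inc = none
  k : s.k = 0
  Δ_pos : 0 < s.Δcurr
  Δ_le : s.Δcurr ≤ par.Δhi
  counter : s.counter = 0
  basket : s.basket = ∅
  t : s.t = fun _ => 0
  speceval : s.speceval = fun _ => false
  pool : s.pool = {τ | τ.1 = 0}
  model_finite : s.model.Finite
  model_origin : ∀ C ∈ s.model, C.origin = none
  model_under : ∀ C ∈ s.model, ∀ x, C.val x ≤ P.Qclus C.cluster x
  stopped : s.stopped = false

/-- A run of Algorithm ATR: `s i` is the state after `i` calls of `act_on_completed_task`. The
tasks may be completed in any order, each with any subgradient; after STOP nothing changes. -/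
structure IsRun (s : ℕ → State n T) : Prop where
  init : H.Init P par (s 0)
  step : ∀ i, (s i).stopped = false → ∃ q j, (q, j) ∈ (s i).pool ∧
    IsSubgradient (P.Qclus j) (H.x q) (H.g q j) ∧ H.Act P par q j (s i) (s (i + 1))
  halt : ∀ i, (s i).stopped = true → s (i + 1) = s i

end History

/-- Every task is completed after a finite time (unless the algorithm stops before). -/
def TasksComplete (s : ℕ → State n T) : Prop :=
  ∀ i, ∀ τ ∈ (s i).pool, ∃ i' ≥ i, (s i').stopped = true ∨ τ ∉ (s i').pool

end

end ATR

/-!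
While the incumbent `x^I` stays fixed, the radii do not increase and the cuts that are active at the
current subproblem solution are kept, so the gaps `Q(x^I) - m^k` decrease. Suppose that their limit
were positive. The `η`-rule would then keep all cuts of late iterates. These iterates lie in a
compact set, on which subgradients of `Q` are bounded, so two of them would be close to each other;
the cuts of the earlier one, which failed the acceptance test, would make the later model value too
large. Hence the gaps tend to `0`.

At a nonoptimal incumbent, convexity yields a `κ > 0` such that the trust region of radius `Δ_k`
contains a point where `Q` is lower by `min(1, Δ_k) κ`, and the gap is at least that large because
the model underestimates `Q`. The radius is reduced only after an iterate with `ρ > 1`, where `Q`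
exceeds `Q(x^I)` by more than `κ`; by continuity this does not happen close to `x^I`, so the radii
are bounded away from zero, and so are the gaps. Therefore a nonoptimal incumbent is replaced, and
the algorithm cannot terminate at it, since a positive gap contradicts the termination test.
-/

open scoped Pointwise
open Filter Topology

namespace ATR

section Convexity

variable {E : Type*} [AddCommGroup E] [Module ℝ E]

theorem convexOn_sInf {V : E → Set ℝ} (hne : ∀ x, (V x).Nonempty) (hbdd : ∀ x, BddBelow (V x))
    (hV : ∀ x y, ∀ a b : ℝ, 0 ≤ a → 0 ≤ b → a + b = 1 → a • V x + b • V y ⊆ V (a • x + b • y)) :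
    ConvexOn ℝ Set.univ fun x => sInf (V x) := by
  refine ⟨convex_univ, fun x _ y _ a b ha hb hab => ?_⟩
  calc sInf (V (a • x + b • y))
      ≤ sInf (a • V x + b • V y) :=
        csInf_le_csInf (hbdd _) ((hne x).smul_set.add (hne y).smul_set) (hV x y a b ha hb hab)
    _ = a • sInf (V x) + b • sInf (V y) := by
        rw [csInf_add (hne x).smul_set ((hbdd x).smul_of_nonneg ha) (hne y).smul_set
          ((hbdd y).smul_of_nonneg hb), Real.sInf_smul_of_nonneg ha, Real.sInf_smul_of_nonneg hb]

theorem convexOn_finsetSum {ι : Type*} {s : Set E} (hs : Convex ℝ s) (t : Finset ι)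
    {f : ι → E → ℝ} (hf : ∀ i ∈ t, ConvexOn ℝ s (f i)) :
    ConvexOn ℝ s fun x => ∑ i ∈ t, f i x := by
  rw [← Finset.sum_fn]
  exact Finset.sum_induction f (ConvexOn ℝ s) (fun _ _ => ConvexOn.add) (convexOn_const 0 hs) hf

end Convexity

theorem exists_decrease_of_convexOn {E : Type*} [SeminormedAddCommGroup E] [NormedSpace ℝ E]
    {s : Set E} {F : E → ℝ} (hF : ConvexOn ℝ s F) {z w : E} (hz : z ∈ s) (hw : w ∈ s)
    (hlt : F w < F z) :
    ∃ κ > 0, ∀ Δ > 0, ∃ x ∈ s, ‖x - z‖ ≤ Δ ∧ F x ≤ F z - min 1 Δ * κ := by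
  have hd : 0 < 1 + ‖w - z‖ := by positivity
  refine ⟨(F z - F w) / (1 + ‖w - z‖), div_pos (sub_pos.2 hlt) hd, fun Δ hΔ => ?_⟩
  set t := min 1 Δ / (1 + ‖w - z‖) with ht
  have ht0 : 0 ≤ t := by positivity
  have ht1 : t ≤ 1 := div_le_one_of_le₀
    ((min_le_left _ _).trans (le_add_of_nonneg_right (norm_nonneg _))) hd.le
  have htd : t * ‖w - z‖ ≤ Δ := calc
    t * ‖w - z‖ ≤ t * (1 + ‖w - z‖) := by gcongr; linarith
    _ = min 1 Δ := div_mul_cancel₀ _ hd.ne'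
    _ ≤ Δ := min_le_right _ _
  have hsum : 1 - t + t = 1 := sub_add_cancel 1 t
  refine ⟨(1 - t) • z + t • w, hF.1 hz hw (sub_nonneg.2 ht1) ht0 hsum, ?_, ?_⟩
  · rwa [show (1 - t) • z + t • w - z = t • (w - z) by module, norm_smul,
      Real.norm_of_nonneg ht0]
  · calc F ((1 - t) • z + t • w) ≤ (1 - t) • F z + t • F w :=
          hF.2 hz hw (sub_nonneg.2 ht1) ht0 hsum
      _ = F z - min 1 Δ * ((F z - F w) / (1 + ‖w - z‖)) := by
          rw [ht]; simp only [smul_eq_mul]; ring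

theorem exists_dotProduct_le_of_isSubgradient {n : ℕ} {F : (Fin n → ℝ) → ℝ} (hF : Continuous F)
    {K : Set (Fin n → ℝ)} (hK : IsCompact K) :
    ∃ D > 0, ∀ z ∈ K, ∀ g, IsSubgradient F z g → ∀ u, g ⬝ᵥ u ≤ D * ‖u‖ := by
  obtain ⟨B, hB⟩ := (hK.cthickening (r := 1)).exists_bound_of_continuousOn hF.continuousOn
  refine ⟨2 * |B| + 1, by positivity, fun z hz g hg u => ?_⟩
  rcases eq_or_ne u 0 with rfl | hu
  · simp
  have hpos : 0 < ‖u‖ := norm_pos_iff.2 hu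
  have hmem : z + ‖u‖⁻¹ • u ∈ Metric.cthickening 1 K := by
    refine Metric.mem_cthickening_of_dist_le _ z _ _ hz ?_
    rw [dist_self_add_left, norm_smul, norm_inv, norm_norm, inv_mul_cancel₀ hpos.ne']
  have hunit : ‖u‖⁻¹ * g ⬝ᵥ u ≤ 2 * |B| + 1 := by
    have h := hg (z + ‖u‖⁻¹ • u)
    rw [add_sub_cancel_left, dotProduct_smul, smul_eq_mul] at h
    have h₁ := abs_le.1 (hB _ hmem)
    have h₂ := abs_le.1 (hB z (Metric.self_subset_cthickening K hz))
    linarith [le_abs_self B]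
  rwa [inv_mul_le_iff₀ hpos, mul_comm] at hunit

theorem exists_frequently_dist_lt {X : Type*} [PseudoMetricSpace X] {K : Set X} (hK : IsCompact K)
    {x : ℕ → X} (hx : ∀ᶠ k in atTop, x k ∈ K) {ε : ℝ} (hε : 0 < ε) (N : ℕ) :
    ∃ l ≥ N, ∃ᶠ k in atTop, dist (x k) (x l) < ε := by
  obtain ⟨a, -, ha⟩ := hK.exists_mapClusterPt (tendsto_principal.2 hx)
  have hfreq := mapClusterPt_iff_frequently.1 ha _ (Metric.ball_mem_nhds a (half_pos hε))
  obtain ⟨l, hl, hla⟩ := frequently_atTop.1 hfreq N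
  exact ⟨l, hl, hfreq.mono fun k hk => (dist_triangle_right _ _ a).trans_lt
    (by linarith [Metric.mem_ball.1 hk, Metric.mem_ball.1 hla])⟩

theorem exists_mul_add_le_of_tendsto {a : ℕ → ℝ} {γ μ : ℝ} (ha : Tendsto a atTop (𝓝 γ))
    (hγ : 0 < γ) (hμ : μ < 1) : ∃ δ > 0, ∃ N, ∀ k ≥ N, ∀ l ≥ N, μ * a l + δ ≤ a k := by
  have hlim : Tendsto (fun p : ℕ × ℕ => a p.1 - μ * a p.2) atTop (𝓝 (γ - μ * γ)) := by
    rw [← prod_atTop_atTop_eq]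
    exact (ha.comp tendsto_fst).sub ((ha.comp tendsto_snd).const_mul μ)
  have hpos : 0 < γ - μ * γ := by nlinarith
  obtain ⟨N, hN⟩ := eventually_atTop_prod_self'.1 (hlim.eventually_const_lt (half_lt_self hpos))
  exact ⟨(γ - μ * γ) / 2, half_pos hpos, N, fun k hk l hl => by linarith [hN k hk l hl]⟩

theorem exists_eq_and_succ_eq {f : ℕ → ℕ} (hstep : ∀ i, f (i + 1) ≤ f i + 1) {i₀ i₁ k : ℕ}
    (h₀ : f i₀ ≤ k) (hi : i₀ ≤ i₁) (h₁ : k < f i₁) : ∃ i ≥ i₀, f i = k ∧ f (i + 1) = k + 1 := by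
  induction i₁, hi using Nat.le_induction with
  | base => omega
  | succ i hi ih =>
    by_cases hik : k < f i
    · exact ih hik
    · exact ⟨i, hi, by have := hstep i; omega⟩

namespace TwoStageLP

variable {n m₁ n₂ m₂ N T : ℕ} {P : TwoStageLP n m₁ n₂ m₂ N T}

theorem Standing.convexOn_Qscen (hP : P.Standing) (i : Fin N) :
    ConvexOn ℝ Set.univ (P.Qscen i) := by
  refine convexOn_sInf (fun x => (hP.complete_recourse i x).image _) (hP.finite_value i) ?_
  rintro x y a b ha hb hab _
    ⟨_, ⟨_, ⟨u, ⟨hu, hu0⟩, rfl⟩, rfl⟩, _, ⟨_, ⟨v, ⟨hv, hv0⟩, rfl⟩, rfl⟩, rfl⟩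
  refine ⟨a • u + b • v, ⟨?_, by positivity⟩, by simp⟩
  calc P.W *ᵥ (a • u + b • v)
      = (a + b) • P.h i - P.tech i *ᵥ (a • x + b • y) := by
        simp only [Matrix.mulVec_add, Matrix.mulVec_smul, hu, hv]
        module
    _ = P.h i - P.tech i *ᵥ (a • x + b • y) := by rw [hab, one_smul]

theorem Standing.convexOn_Q (hP : P.Standing) : ConvexOn ℝ Set.univ P.Q :=
  (show ConvexOn ℝ Set.univ fun x => P.c ⬝ᵥ x from
    ((dotProductBilin ℝ ℝ) P.c).convexOn convex_univ).add
  (convexOn_finsetSum convex_univ _ fun i _ => (hP.convexOn_Qscen i).smul (hP.p_nonneg i))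

theorem Standing.continuous_Q (hP : P.Standing) : Continuous P.Q :=
  hP.convexOn_Q.locallyLipschitz.continuous

theorem Q_eq_sum_Qclus (x : Fin n → ℝ) : P.Q x = P.c ⬝ᵥ x + ∑ j, P.Qclus j x := by
  simp only [Q, Qclus, Finset.sum_fiberwise]

theorem convex_feasible : Convex ℝ P.feasible := by
  rintro x ⟨hx, hx0⟩ y ⟨hy, hy0⟩ a b ha hb hab
  exact ⟨by rw [Matrix.mulVec_add, Matrix.mulVec_smul, Matrix.mulVec_smul, hx, hy, ← add_smul,
    hab, one_smul], by positivity⟩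

theorem trustRegion_eq (z : Fin n → ℝ) (Δ : ℝ) :
    P.trustRegion z Δ = P.feasible ∩ Metric.closedBall z Δ := by
  ext x
  rw [Set.mem_inter_iff, mem_closedBall_iff_norm]
  rfl

theorem convex_trustRegion (z : Fin n → ℝ) (Δ : ℝ) : Convex ℝ (P.trustRegion z Δ) := by
  rw [trustRegion_eq]
  exact convex_feasible.inter (convex_closedBall z Δ)

theorem Standing.exists_decrease (hP : P.Standing) {z : Fin n → ℝ} (hz : z ∈ P.feasible)
    (hzS : z ∉ P.solutionSet) :
    ∃ κ > 0, ∀ Δ > 0, ∃ x ∈ P.trustRegion z Δ, P.Q x ≤ P.Q z - min 1 Δ * κ := by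
  obtain ⟨w, hw, hlt⟩ : ∃ w ∈ P.feasible, P.Q w < P.Q z := by
    by_contra! h
    exact hzS ⟨hz, h⟩
  obtain ⟨κ, hκ, hdec⟩ := exists_decrease_of_convexOn
    (hP.convexOn_Q.subset (Set.subset_univ _) convex_feasible) hz hw hlt
  refine ⟨κ, hκ, fun Δ hΔ => ?_⟩
  obtain ⟨x, hx, hxz, hle⟩ := hdec Δ hΔ
  exact ⟨x, ⟨hx, hxz⟩, hle⟩

end TwoStageLP

section Model

variable {n m₁ n₂ m₂ N T : ℕ} {P : TwoStageLP n m₁ n₂ m₂ N T} {M M' : Set (Cut n T)}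
  {x y : Fin n → ℝ} {j : Fin T}

theorem coe_sum_eReal {ι : Type*} (s : Finset ι) (v : ι → ℝ) :
    ((∑ i ∈ s, v i : ℝ) : EReal) = ∑ i ∈ s, (v i : EReal) :=
  map_sum (⟨⟨Real.toEReal, EReal.coe_zero⟩, EReal.coe_add⟩ : ℝ →+ EReal) v s

theorem val_le_clusterModel {C : Cut n T} (hC : C ∈ M) (x : Fin n → ℝ) :
    (C.val x : EReal) ≤ clusterModel M C.cluster x :=
  le_iSup₂_of_le (f := fun D (_ : D ∈ {D ∈ M | D.cluster = C.cluster}) => (D.val x : EReal))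
    C ⟨hC, rfl⟩ le_rfl

theorem clusterModel_le_iff {a : EReal} :
    clusterModel M j x ≤ a ↔ ∀ C ∈ M, C.cluster = j → (C.val x : EReal) ≤ a := by
  simp only [clusterModel, iSup_le_iff, Set.mem_ofPred_eq, and_imp]

theorem clusterModel_mono (h : M ⊆ M') : clusterModel M j x ≤ clusterModel M' j x :=
  clusterModel_le_iff.2 fun _ hC hj => hj ▸ val_le_clusterModel (h hC) x

theorem exists_cut_of_clusterModel_ne_bot (h : clusterModel M j x ≠ ⊥) :
    ∃ C ∈ M, C.cluster = j := by
  contrapose! h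
  exact le_bot_iff.1 (clusterModel_le_iff.2 fun C hC hj => (h C hC hj).elim)

theorem exists_clusterModel_eq (hM : M.Finite) (hj : ∃ C ∈ M, C.cluster = j) (x : Fin n → ℝ) :
    ∃ C ∈ M, C.cluster = j ∧ clusterModel M j x = C.val x := by
  obtain ⟨C, ⟨hC, rfl⟩, hmax⟩ := Set.exists_max_image {C ∈ M | C.cluster = j} (Cut.val · x)
    (hM.subset (Set.sep_subset _ _)) hj
  refine ⟨C, hC, rfl, le_antisymm (clusterModel_le_iff.2 fun D hD hDj => ?_)
    (val_le_clusterModel hC x)⟩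
  exact EReal.coe_le_coe_iff.2 (hmax D ⟨hD, hDj⟩)

theorem Cut.val_lineMap (C : Cut n T) (x y : Fin n → ℝ) (t : ℝ) :
    C.val (AffineMap.lineMap x y t) = AffineMap.lineMap (C.val x) (C.val y) t := by
  simp only [Cut.val, AffineMap.lineMap_apply_module',
    dotProduct_add, dotProduct_smul, dotProduct_sub, smul_eq_mul]
  ring

/-- The cuts of `M` that attain the maximum of the model of their cluster at `x`. -/
def activeCuts (M : Set (Cut n T)) (x : Fin n → ℝ) : Set (Cut n T) :=
  {C ∈ M | (C.val x : EReal) = clusterModel M C.cluster x}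

theorem eventually_val_lineMap_le (hM : M.Finite) {α β : Fin T → ℝ}
    (hα : ∀ C ∈ M, C.val x ≤ α C.cluster)
    (hβ : ∀ C ∈ M, C.val x = α C.cluster → C.val y ≤ β C.cluster) :
    ∀ᶠ t in 𝓝[>] (0 : ℝ), ∀ C ∈ M,
      C.val (AffineMap.lineMap x y t) ≤ AffineMap.lineMap (α C.cluster) (β C.cluster) t := by
  refine (eventually_all_finite hM).2 fun C hC => ?_
  simp only [Cut.val_lineMap]
  rcases (hα C hC).eq_or_lt with heq | hlt
  · filter_upwards [Ioo_mem_nhdsGT one_pos] with t ht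
    exact lineMap_mono_endpoints heq.le (hβ C hC heq) ht.1.le ht.2.le
  · have hlim (a b : ℝ) : Tendsto (AffineMap.lineMap a b) (𝓝[>] (0 : ℝ)) (𝓝 a) :=
      (AffineMap.lineMap_continuous.tendsto' 0 a (AffineMap.lineMap_apply_zero a b)).mono_left
        nhdsWithin_le_nhds
    exact ((hlim _ _).eventually_lt (hlim _ _) hlt).mono fun _ => le_of_lt

namespace TwoStageLP

theorem le_model {v : Fin T → ℝ} (h : ∀ j, (v j : EReal) ≤ clusterModel M j x) :
    ((P.c ⬝ᵥ x + ∑ j, v j : ℝ) : EReal) ≤ P.model M x := by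
  rw [EReal.coe_add, coe_sum_eReal]
  exact add_le_add le_rfl (Finset.sum_le_sum fun j _ => h j)

theorem model_le {v : Fin T → ℝ} (h : ∀ C ∈ M, C.val x ≤ v C.cluster) :
    P.model M x ≤ ((P.c ⬝ᵥ x + ∑ j, v j : ℝ) : EReal) := by
  rw [EReal.coe_add, coe_sum_eReal]
  refine add_le_add le_rfl (Finset.sum_le_sum fun j _ => clusterModel_le_iff.2 ?_)
  rintro C hC rfl
  exact EReal.coe_le_coe_iff.2 (h C hC)

theorem model_mono (h : M ⊆ M') (x : Fin n → ℝ) : P.model M x ≤ P.model M' x :=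
  add_le_add le_rfl (Finset.sum_le_sum fun _ _ => clusterModel_mono h)

theorem model_le_Q (h : ∀ C ∈ M, ∀ x, C.val x ≤ P.Qclus C.cluster x) (x : Fin n → ℝ) :
    P.model M x ≤ P.Q x := by
  rw [Q_eq_sum_Qclus]
  exact model_le fun C hC => h C hC x

theorem clusterModel_ne_bot (h : P.model M x ≠ ⊥) (j : Fin T) : clusterModel M j x ≠ ⊥ := by
  contrapose! h
  rw [model, ← Finset.add_sum_erase _ _ (Finset.mem_univ j), h, EReal.bot_add, EReal.add_bot]

/-- If moving from `x` towards `y` decreased the model of the active cuts, then, for a short step,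
it would decrease the whole model: the other cuts are not attained near `x`. -/
theorem model_le_model_activeCuts (hM : M.Finite) {S : Set (Fin n → ℝ)} (hS : Convex ℝ S)
    (hx : x ∈ S) (hmin : IsMinOn (P.model M) S x) (hy : y ∈ S) :
    P.model M x ≤ P.model (activeCuts M x) y := by
  by_cases hbot : P.model M x = ⊥
  · exact hbot ▸ bot_le
  choose A hAM hA hαA using fun j => exists_clusterModel_eq hM
    (exists_cut_of_clusterModel_ne_bot (clusterModel_ne_bot hbot j)) x
  have hact : ∀ j, ∃ C ∈ activeCuts M x, C.cluster = j := fun j =>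
    ⟨A j, ⟨hAM j, by rw [hA, hαA]⟩, hA j⟩
  choose B _ _ hβB using fun j =>
    exists_clusterModel_eq (hM.subset (Set.sep_subset _ _)) (hact j) y
  set α := fun j => (A j).val x
  set β := fun j => (B j).val y
  have hαM : ∀ C ∈ M, C.val x ≤ α C.cluster := fun C hC =>
    EReal.coe_le_coe_iff.1 (hαA C.cluster ▸ val_le_clusterModel hC x)
  have hβM : ∀ C ∈ M, C.val x = α C.cluster → C.val y ≤ β C.cluster := fun C hC hCx =>
    EReal.coe_le_coe_iff.1
      (hβB C.cluster ▸ val_le_clusterModel (M := activeCuts M x) ⟨hC, by rw [hαA, hCx]⟩ y)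
  obtain ⟨t, hval, ht0, ht1⟩ :=
    ((eventually_val_lineMap_le hM hαM hβM).and (Ioo_mem_nhdsGT one_pos)).exists
  have hstep : P.c ⬝ᵥ x + ∑ j, α j ≤ P.c ⬝ᵥ AffineMap.lineMap x y t +
      ∑ j, AffineMap.lineMap (α j) (β j) t := by
    rw [← EReal.coe_le_coe_iff]
    exact ((le_model fun j => (hαA j).ge).trans
      (hmin (hS.lineMap_mem hx hy ⟨ht0.le, ht1.le⟩))).trans (model_le hval)
  have hβα : P.c ⬝ᵥ x + ∑ j, α j ≤ P.c ⬝ᵥ y + ∑ j, β j := by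
    simp only [AffineMap.lineMap_apply_module', dotProduct_add,
      dotProduct_smul, dotProduct_sub, smul_eq_mul, Finset.sum_add_distrib, ← Finset.mul_sum,
      Finset.sum_sub_distrib] at hstep
    nlinarith
  calc P.model M x ≤ ((P.c ⬝ᵥ x + ∑ j, α j : ℝ) : EReal) := model_le hαM
    _ ≤ ((P.c ⬝ᵥ y + ∑ j, β j : ℝ) : EReal) := EReal.coe_le_coe_iff.2 hβα
    _ ≤ P.model (activeCuts M x) y := le_model fun j => (hβB j).ge

theorem isSubgradient_Q {z : Fin n → ℝ} {g : Fin T → Fin n → ℝ}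
    (hg : ∀ j, IsSubgradient (P.Qclus j) z (g j)) :
    IsSubgradient P.Q z (P.c + ∑ j, g j) := by
  intro x
  have hsum := Finset.sum_le_sum fun j (_ : j ∈ Finset.univ) => hg j x
  rw [Finset.sum_add_distrib] at hsum
  rw [Q_eq_sum_Qclus, Q_eq_sum_Qclus, add_dotProduct, sum_dotProduct, dotProduct_sub]
  linarith

end TwoStageLP

theorem History.cut_val (H : History n T) (P : TwoStageLP n m₁ n₂ m₂ N T) (q : ℕ) (j : Fin T)
    (x : Fin n → ℝ) :
    (H.cut P q j).val x = P.Qclus j (H.x q) + H.g q j ⬝ᵥ (x - H.x q) := by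
  simp only [Cut.val, History.cut, dotProduct_sub]
  ring

theorem History.Q_add_le_model {H : History n T} {q : ℕ} (h : ∀ j, H.cut P q j ∈ M)
    (x : Fin n → ℝ) :
    ((P.Q (H.x q) + (P.c + ∑ j, H.g q j) ⬝ᵥ (x - H.x q) : ℝ) : EReal) ≤ P.model M x := by
  have heq : P.Q (H.x q) + (P.c + ∑ j, H.g q j) ⬝ᵥ (x - H.x q) =
      P.c ⬝ᵥ x + ∑ j, (H.cut P q j).val x := by
    simp only [H.cut_val, Finset.sum_add_distrib, TwoStageLP.Q_eq_sum_Qclus, add_dotProduct,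
      sum_dotProduct, dotProduct_sub, Finset.sum_sub_distrib]
    ring
  rw [heq]
  exact TwoStageLP.le_model fun j => val_le_clusterModel (h j) x

end Model

section Invariants

variable {n m₁ n₂ m₂ N T : ℕ}

/-- Every task of the iterate with index `q` has been completed. This is the meaning of the test
`t q = T` of the algorithm. -/
def State.Evaluated (s : State n T) (q : ℕ) : Prop := ∀ j, (q, j) ∉ s.pool

namespace History

variable (H : History n T) (P : TwoStageLP n m₁ n₂ m₂ N T) (par : Params)

/-- The amount `Q(x^r) - m^k` by which the subproblem solved for `x^k` promises to improve on the
incumbent `x^r`. -/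
noncomputable def gap (r k : ℕ) : ℝ := P.Q (H.x r) - H.m k

/-- The iterate `x^q` solves, with optimal value `m^q`, the trust-region subproblem centered at
`x^r` for a model consisting of finitely many valid cuts. -/
structure IterateSpec (q r : ℕ) : Prop where
  finite : (H.cuts q).Finite
  under : ∀ C ∈ H.cuts q, ∀ x, C.val x ≤ P.Qclus C.cluster x
  solves : P.SolvesTrsub (H.cuts q) (H.x r) (H.Δ q) (H.x q)
  m_eq : (H.m q : EReal) = P.model (H.cuts q) (H.x q)

/-- The invariant of the incumbent, the radius, the model and the iterates. It also holds in the
intermediate states inside `act_on_completed_task`. -/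
structure DataInvariant (s : State n T) : Prop where
  Δcurr_pos : 0 < s.Δcurr
  model_finite : s.model.Finite
  model_under : ∀ C ∈ s.model, ∀ x, C.val x ≤ P.Qclus C.cluster x
  inc_le : ∀ r, s.inc = some r → r ≤ s.k
  Δ_pos : ∀ q ≤ s.k, 0 < H.Δ q
  x_mem : ∀ q ≤ s.k, H.x q ∈ P.feasible
  iterateSpec : ∀ q ≤ s.k, ∀ r, H.parent q = some r → H.IterateSpec P q r

/-- The invariant of the task pool while the algorithm is running. -/
structure TaskInvariant (s : State n T) : Prop where
  pool_le : ∀ τ ∈ s.pool, τ.1 ≤ s.k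
  count : ∀ q ≤ s.k, s.t q + {j | (q, j) ∈ s.pool}.ncard = T
  isSubgradient : ∀ q ≤ s.k, ∀ j, (q, j) ∉ s.pool →
    IsSubgradient (P.Qclus j) (H.x q) (H.g q j)

/-- The invariant that holds while the algorithm waits for the completion of a task. -/
structure WaitingInvariant (s : State n T) : Prop extends TaskInvariant H P s where
  not_evaluated_k : ¬ s.Evaluated s.k
  not_convTest : ∀ q ≤ s.k, ¬ H.ConvTest P par (H.parent q) q
  not_accept : ∀ q ≤ s.k, s.Evaluated q → ¬ H.Accept P par s.inc q

/-- The invariant that holds between two calls of `act_on_completed_task`. -/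
structure Invariant (s : State n T) : Prop extends DataInvariant H P s where
  parent_k : H.parent s.k = s.inc
  Δ_k : H.Δ s.k = s.Δcurr
  cuts_subset : s.inc ≠ none → H.cuts s.k ⊆ s.model
  convTest : s.stopped = true → H.ConvTest P par s.inc s.k
  waiting : s.stopped = false → H.WaitingInvariant P par s

variable {H P par} {s s' : State n T} {q r : ℕ} {j : Fin T} {I : Option ℕ}

theorem IterateSpec.m_le_Q (h : H.IterateSpec P q r) {x : Fin n → ℝ}
    (hx : x ∈ P.trustRegion (H.x r) (H.Δ q)) : H.m q ≤ P.Q x := by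
  rw [← EReal.coe_le_coe_iff, h.m_eq]
  exact (h.solves.2 x hx).trans (TwoStageLP.model_le_Q h.under x)

theorem not_accept_self : ¬ H.Accept P par (some q) q := fun h => (h.1 q rfl).false

theorem Accept.trans {q' : ℕ} (h : H.Accept P par I q) (h' : H.Accept P par (some q) q') :
    H.Accept P par I q' :=
  ⟨fun r hr => (h'.1 q rfl).trans (h.1 r hr), h'.2⟩

theorem not_convTest_none {k : ℕ} : ¬ H.ConvTest P par none k := by
  rintro ⟨r, hr, -⟩
  exact Option.some_ne_none r hr.symm

theorem convTest_some_iff (htol : par.εtol = 0) {k : ℕ} :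
    H.ConvTest P par (some r) k ↔ H.gap P r k ≤ 0 := by
  simp only [ConvTest, Option.some.injEq, exists_eq_left', htol, zero_mul, gap]

theorem TaskInvariant.t_eq_of_evaluated (h : H.TaskInvariant P s) (hq : q ≤ s.k)
    (hev : s.Evaluated q) : s.t q = T := by
  simpa [Set.eq_empty_of_forall_notMem (s := {j | (q, j) ∈ s.pool}) hev] using h.count q hq

theorem IncreaseΔ.le {Δ Δ' : ℝ} (h : H.IncreaseΔ P par q Δ Δ') : Δ ≤ Δ' := by
  unfold IncreaseΔ at h
  split at h
  · rcases h with rfl | ⟨-, rfl⟩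
    exacts [le_rfl, le_max_left _ _]
  · by_contra hlt
    have hne : Δ' ≠ max Δ (min par.Δhi (2 * H.Δ q)) := fun he => hlt (he ▸ le_max_left _ _)
    exact hlt (h.2 fun ht => hne (h.1 ht)).ge

theorem reduceΔ_eq_or (q : ℕ) (Δcurr : ℝ) (counter : ℕ) :
    (H.reduceΔ P q Δcurr counter).1 = Δcurr ∨ ∃ r, H.parent q = some r ∧ 1 < H.ρ P q r ∧
      (H.reduceΔ P q Δcurr counter).1 = min Δcurr (H.Δ q / min (H.ρ P q r) 4) := by
  unfold reduceΔ
  split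
  · exact Or.inl rfl
  case _ r hr =>
    dsimp only
    split_ifs with hρ hred hred
    all_goals first
      | exact Or.inl rfl
      | exact Or.inr ⟨r, hr, hred.elim (fun h => by linarith) fun h => h.2.1, rfl⟩

theorem reduceΔ_le (q : ℕ) (Δcurr : ℝ) (counter : ℕ) :
    (H.reduceΔ P q Δcurr counter).1 ≤ Δcurr := by
  rcases H.reduceΔ_eq_or (P := P) q Δcurr counter with h | ⟨r, -, -, h⟩
  exacts [h.le, h.le.trans (min_le_left _ _)]

theorem reduceΔ_eq_or_le {Δcurr : ℝ} {counter : ℕ} (hq : 0 < H.Δ q) :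
    (H.reduceΔ P q Δcurr counter).1 = Δcurr ∨ ∃ r, H.parent q = some r ∧ 1 < H.ρ P q r ∧
      min Δcurr (H.Δ q / 4) ≤ (H.reduceΔ P q Δcurr counter).1 := by
  refine (reduceΔ_eq_or q Δcurr counter).imp_right ?_
  rintro ⟨r, hr, hρ, heq⟩
  refine ⟨r, hr, hρ, heq ▸ min_le_min le_rfl ?_⟩
  exact div_le_div_of_nonneg_left hq.le (lt_min (by linarith) (by norm_num)) (min_le_right _ _)

theorem reduceΔ_pos {Δcurr : ℝ} {counter : ℕ} (hΔ : 0 < Δcurr) (hq : 0 < H.Δ q) :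
    0 < (H.reduceΔ P q Δcurr counter).1 := by
  rcases reduceΔ_eq_or_le (P := P) (Δcurr := Δcurr) (counter := counter) hq with h | ⟨r, -, -, h⟩
  exacts [h.symm ▸ hΔ, (lt_min hΔ (by linarith)).trans_le h]

theorem Trigger.frame (h : H.Trigger P par q s s') :
    s'.k = s.k ∧ s'.t = s.t ∧ s'.pool = s.pool ∧ s'.model ⊆ s.model := by
  cases h with
  | accept _ _ _ _ _ sub => exact ⟨rfl, rfl, rfl, sub⟩
  | reject _ _ _ upd => exact ⟨rfl, rfl, rfl, upd.1⟩
  | fill => exact ⟨rfl, rfl, rfl, subset_rfl⟩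

theorem Trigger.inc_eq_or (h : H.Trigger P par q s s') :
    s'.inc = s.inc ∨ s'.inc = some q ∧ H.Accept P par s.inc q := by
  cases h with
  | accept _ _ _ acc => exact Or.inr ⟨rfl, acc⟩
  | reject => exact Or.inl rfl
  | fill => exact Or.inl rfl

theorem Trigger.of_inc_eq (h : H.Trigger P par q s s') (hinc : s'.inc = s.inc) :
    (∀ C ∈ s.model, H.Protected P par s.k C → C ∈ s'.model) ∧
      (s'.Δcurr = s.Δcurr ∨ s'.Δcurr = (H.reduceΔ P q s.Δcurr s.counter).1) := by
  cases h with
  | accept _ _ _ acc =>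
    rw [← hinc] at acc
    exact (not_accept_self acc).elim
  | reject _ _ _ upd => exact ⟨upd.2, Or.inr rfl⟩
  | fill => exact ⟨fun _ hC _ => hC, Or.inl rfl⟩

theorem NewIterate.frame (h : H.NewIterate P par s s') :
    s'.k = s.k + 1 ∧ s'.inc = s.inc ∧ s'.model = s.model ∧ s'.Δcurr = s.Δcurr := by
  by_cases hc : H.ConvTest P par s.inc (s.k + 1)
  · rw [h.halts hc]
    exact ⟨rfl, rfl, rfl, rfl⟩
  · rw [h.go_on hc]
    exact ⟨rfl, rfl, rfl, rfl⟩

theorem NewIterate.running (h : H.NewIterate P par s s') (hs' : s'.stopped = false) :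
    ¬ H.ConvTest P par s.inc (s.k + 1) ∧
      s'.t = Function.update s.t (s.k + 1) 0 ∧ s'.pool = s.pool ∪ {τ | τ.1 = s.k + 1} := by
  by_cases hc : H.ConvTest P par s.inc (s.k + 1)
  · simp [h.halts hc] at hs'
  · rw [h.go_on hc]
    exact ⟨hc, rfl, rfl⟩

theorem NewIterate.convTest (h : H.NewIterate P par s s') (hs : s.stopped = false)
    (hs' : s'.stopped = true) : H.ConvTest P par s'.inc s'.k := by
  rw [h.frame.1, h.frame.2.1]
  by_contra hc
  simp [h.go_on hc, hs] at hs'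

theorem DataInvariant.record (h : H.DataInvariant P s)
    (hg : IsSubgradient (P.Qclus j) (H.x q) (H.g q j)) :
    H.DataInvariant P (H.record P q j s) :=
  { h with
    model_finite := h.model_finite.insert _
    model_under := by
      rintro C (rfl | hC) x
      · exact (H.cut_val P q j x).trans_le (hg x)
      · exact h.model_under C hC x }

theorem DataInvariant.trigger (h : H.DataInvariant P s) (hq : q ≤ s.k)
    (ht : H.Trigger P par q s s') : H.DataInvariant P s' := by
  cases ht with
  | accept _ _ _ _ radius sub =>
    exact { h with
      Δcurr_pos := h.Δcurr_pos.trans_le radius.le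
      model_finite := h.model_finite.subset sub
      model_under := fun C hC => h.model_under C (sub hC)
      inc_le := by rintro _ ⟨⟩; exact hq }
  | reject _ _ _ upd =>
    exact { h with
      Δcurr_pos := reduceΔ_pos h.Δcurr_pos (h.Δ_pos q hq)
      model_finite := h.model_finite.subset upd.1
      model_under := fun C hC => h.model_under C (upd.1 hC) }
  | fill => exact { h with }

theorem NewIterate.iterateSpec (hn : H.NewIterate P par s s') (h : H.DataInvariant P s)
    (hr : H.parent (s.k + 1) = some r) : H.IterateSpec P (s.k + 1) r := by
  have hinc : s.inc = some r := hn.parent_eq.symm.trans hr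
  have hsolves := hn.solves
  rw [hinc, ← hn.cuts_eq, ← hn.Δ_eq] at hsolves
  exact
    { finite := hn.cuts_eq ▸ h.model_finite
      under := hn.cuts_eq ▸ h.model_under
      solves := hsolves
      m_eq := hn.cuts_eq ▸ hn.m_eq (hinc ▸ Option.some_ne_none r) }

theorem DataInvariant.newIterate (h : H.DataInvariant P s) (hn : H.NewIterate P par s s') :
    H.DataInvariant P s' := by
  obtain ⟨hk, hinc, hmodel, hΔ⟩ := hn.frame
  have hforall {p : ℕ → Prop} (hp : ∀ q ≤ s.k, p q) (hp' : p (s.k + 1)) : ∀ q ≤ s'.k, p q := by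
    intro q hq
    rcases Nat.le_succ_iff.1 (hk ▸ hq) with hq | rfl
    exacts [hp q hq, hp']
  exact
    { Δcurr_pos := hΔ ▸ h.Δcurr_pos
      model_finite := hmodel ▸ h.model_finite
      model_under := hmodel ▸ h.model_under
      inc_le := fun r hr => hk ▸ (h.inc_le r (hinc ▸ hr)).trans (Nat.le_succ _)
      Δ_pos := hforall h.Δ_pos (hn.Δ_eq ▸ h.Δcurr_pos)
      x_mem := hforall h.x_mem hn.solves.1.1
      iterateSpec := hforall h.iterateSpec fun _ => hn.iterateSpec h }

theorem TaskInvariant.record (h : H.TaskInvariant P s) (hqj : (q, j) ∈ s.pool)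
    (hg : IsSubgradient (P.Qclus j) (H.x q) (H.g q j)) :
    H.TaskInvariant P (H.record P q j s) where
  pool_le τ hτ := h.pool_le τ hτ.1
  count q' hq' := by
    refine Eq.trans ?_ (h.count q' hq')
    rcases eq_or_ne q' q with rfl | hne
    · have hopen : {j' | (q', j') ∈ s.pool \ {(q', j)}} = {j' | (q', j') ∈ s.pool} \ {j} := by
        ext j'
        simp
      simp only [History.record, Function.update_self, hopen]
      have hj : j ∈ {j' | (q', j') ∈ s.pool} := hqj
      rw [add_assoc, add_comm 1, Set.ncard_sdiff_singleton_add_one hj]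
    · simp [History.record, hne]
  isSubgradient q' hq' j' hn := by
    by_cases heq : (q', j') = (q, j)
    · obtain ⟨rfl, rfl⟩ := Prod.mk.inj heq
      exact hg
    · exact h.isSubgradient q' hq' j' fun hm => hn ⟨hm, heq⟩

theorem TaskInvariant.trigger (h : H.TaskInvariant P s) (ht : H.Trigger P par q s s') :
    H.TaskInvariant P s' := by
  obtain ⟨hk, ht, hp, -⟩ := ht.frame
  exact ⟨by simpa only [hp, hk] using h.pool_le, by simpa only [hp, ht, hk] using h.count,
    by simpa only [hp, hk] using h.isSubgradient⟩

theorem TaskInvariant.newIterate (h : H.TaskInvariant P s) (hn : H.NewIterate P par s s')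
    (hs' : s'.stopped = false) : H.TaskInvariant P s' := by
  obtain ⟨-, ht, hp⟩ := hn.running hs'
  obtain ⟨hk, -⟩ := hn.frame
  refine ⟨?_, fun q hq => ?_, fun q hq j hj => ?_⟩
  · rw [hp, hk]
    rintro τ (hτ | hτ)
    exacts [(h.pool_le τ hτ).trans (Nat.le_succ _), le_of_eq hτ]
  · rcases Nat.le_succ_iff.1 (hk ▸ hq) with hq | rfl
    · have hne : q ≠ s.k + 1 := by omega
      simpa [ht, hp, hne] using h.count q hq
    · simp [ht, hp]
  · rw [hp] at hj
    have hne : q ≠ s.k + 1 := fun he => hj (Or.inr he)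
    exact h.isSubgradient q (by omega) j fun hm => hj (Or.inl hm)

theorem Trigger.not_accept (ht : H.Trigger P par q s s') (h : H.TaskInvariant P s)
    (hacc : ∀ q' ≤ s.k, q' ≠ q → s.Evaluated q' → ¬ H.Accept P par s.inc q') :
    ∀ q' ≤ s'.k, s'.Evaluated q' → ¬ H.Accept P par s'.inc q' := by
  intro q' hq' hev
  cases ht with
  | accept _ _ _ acc =>
    rcases eq_or_ne q' q with rfl | hne
    · exact not_accept_self
    · exact fun hacc' => hacc q' hq' hne hev (acc.trans hacc')
  | reject _ _ rej =>
    rcases eq_or_ne q' q with rfl | hne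
    exacts [rej, hacc q' hq' hne hev]
  | fill test =>
    refine hacc q' hq' ?_ hev
    rintro rfl
    exact test.1 (h.t_eq_of_evaluated hq' hev)

theorem WaitingInvariant.not_accept_record (h : H.WaitingInvariant P par s) :
    ∀ q' ≤ s.k, q' ≠ q → (H.record P q j s).Evaluated q' → ¬ H.Accept P par s.inc q' :=
  fun q' hq' hne hev => h.not_accept q' hq' fun j' hj' => hev j' ⟨hj', by simp [hne]⟩

theorem WaitingInvariant.generate (h : H.WaitingInvariant P par s) (hqj : (q, j) ∈ s.pool)
    (hg : IsSubgradient (P.Qclus j) (H.x q) (H.g q j)) {s₂ : State n T}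
    (trig : H.Trigger P par q (H.record P q j s) s₂) (new : H.NewIterate P par s₂ s')
    (hs' : s'.stopped = false) : H.WaitingInvariant P par s' := by
  have htask := h.toTaskInvariant.record hqj hg
  obtain ⟨hconv, -, hp⟩ := new.running hs'
  obtain ⟨hk, hinc, -⟩ := new.frame
  have hk₂ : s₂.k = s.k := trig.frame.1
  refine ⟨(htask.trigger trig).newIterate new hs', ?_, fun q' hq' => ?_, fun q' hq' hev => ?_⟩
  · rw [hk]
    exact fun hev => hev j (hp ▸ Or.inr rfl)
  · rcases Nat.le_succ_iff.1 (hk ▸ hq') with hq' | rfl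
    · exact h.not_convTest q' (hk₂ ▸ hq')
    · rwa [new.parent_eq]
  · have hne : q' ≠ s₂.k + 1 := fun he => hev j (hp ▸ Or.inr he)
    rw [hinc]
    exact trig.not_accept htask h.not_accept_record q' (by omega)
      fun j' hj' => hev j' (hp ▸ Or.inl hj')

theorem WaitingInvariant.idle (h : H.WaitingInvariant P par s) (hqj : (q, j) ∈ s.pool)
    (hg : IsSubgradient (P.Qclus j) (H.x q) (H.g q j)) (hT : (H.record P q j s).t q ≠ T) :
    H.WaitingInvariant P par (H.record P q j s) := by
  have htask := h.toTaskInvariant.record hqj hg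
  have hne {q'} (hq' : q' ≤ s.k) (hev : (H.record P q j s).Evaluated q') : q' ≠ q := by
    rintro rfl
    exact hT (htask.t_eq_of_evaluated hq' hev)
  exact
    { htask with
      not_evaluated_k := fun hev => h.not_evaluated_k fun j' hj' =>
        hev j' ⟨hj', fun he => hne le_rfl hev (congrArg Prod.fst he)⟩
      not_convTest := h.not_convTest
      not_accept := fun q' hq' hev => h.not_accept_record q' hq' (hne hq' hev) hev }

theorem Invariant.act (h : H.Invariant P par s) (hs : s.stopped = false) (hqj : (q, j) ∈ s.pool)
    (hg : IsSubgradient (P.Qclus j) (H.x q) (H.g q j)) (ha : H.Act P par q j s s') :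
    H.Invariant P par s' := by
  have hw := h.waiting hs
  have hrec := h.toDataInvariant.record (j := j) hg
  cases ha with
  | idle not_full =>
    exact
      { hrec with
        parent_k := h.parent_k
        Δ_k := h.Δ_k
        cuts_subset := fun hinc => (h.cuts_subset hinc).trans (Set.subset_insert _ _)
        convTest := h.convTest
        waiting := fun _ => hw.idle hqj hg not_full }
  | generate s₂ _ trig new =>
    obtain ⟨hk, hinc, hmodel, hΔ⟩ := new.frame
    have hs₂ : s₂.stopped = false := by cases trig <;> exact hs
    exact
      { (hrec.trigger (hw.pool_le _ hqj) trig).newIterate new with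
        parent_k := by rw [hk, new.parent_eq, hinc]
        Δ_k := by rw [hk, new.Δ_eq, hΔ]
        cuts_subset := fun _ => by rw [hk, new.cuts_eq, hmodel]
        convTest := new.convTest hs₂
        waiting := hw.generate hqj hg trig new }

theorem Init.invariant (h : H.Init P par s) (hT : 0 < T) : H.Invariant P par s where
  Δcurr_pos := h.Δ_pos
  model_finite := h.model_finite
  model_under := h.model_under
  inc_le r hr := by simp [h.inc] at hr
  Δ_pos q hq := by
    obtain rfl : q = 0 := by simpa [h.k] using hq
    exact h.Δ_zero ▸ h.Δ_pos
  x_mem q hq := by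
    obtain rfl : q = 0 := by simpa [h.k] using hq
    exact h.start
  iterateSpec q hq r hr := by
    obtain rfl : q = 0 := by simpa [h.k] using hq
    simp [h.parent_zero] at hr
  parent_k := by rw [h.k, h.parent_zero, h.inc]
  Δ_k := by rw [h.k, h.Δ_zero]
  cuts_subset hinc := (hinc h.inc).elim
  convTest hs := by simp [h.stopped] at hs
  waiting _ := by
    have hev : ¬ s.Evaluated 0 := fun hev => hev ⟨0, hT⟩ (h.pool ▸ rfl)
    have hzero {q} (hq : q ≤ s.k) : q = 0 := by simpa [h.k] using hq
    refine ⟨⟨?_, ?_, ?_⟩, ?_, ?_, ?_⟩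
    · simp [h.pool]
    · intro q hq
      simp [hzero hq, h.pool, h.t]
    · intro q hq j hj
      exact (hj (by simp [hzero hq, h.pool])).elim
    · rwa [h.k]
    · intro q hq
      rw [hzero hq, h.parent_zero]
      exact not_convTest_none
    · intro q hq hq'
      exact (hev (hzero hq ▸ hq')).elim

theorem Act.inc_eq_or (ha : H.Act P par q j s s') :
    s'.inc = s.inc ∨ s'.inc = some q ∧ H.Accept P par s.inc q := by
  cases ha with
  | idle => exact Or.inl rfl
  | generate s₂ _ trig new => exact new.frame.2.1 ▸ trig.inc_eq_or

theorem Act.k_eq_or (ha : H.Act P par q j s s') : s'.k = s.k ∨ s'.k = s.k + 1 := by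
  cases ha with
  | idle => exact Or.inl rfl
  | generate s₂ _ trig new => exact Or.inr (new.frame.1.trans (congrArg (· + 1) trig.frame.1))

theorem Act.pool_eq (ha : H.Act P par q j s s') (hs' : s'.stopped = false) :
    s'.pool = (s.pool \ {(q, j)}) ∪ {τ | s.k < τ.1 ∧ τ.1 ≤ s'.k} := by
  cases ha with
  | idle =>
    have hempty : {τ : ℕ × Fin T | s.k < τ.1 ∧ τ.1 ≤ s.k} = ∅ :=
      Set.eq_empty_of_forall_notMem fun τ hτ => (hτ.1.trans_le hτ.2).false
    exact (hempty ▸ Set.union_empty _).symm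
  | generate s₂ _ trig new =>
    have hk₂ : s₂.k = s.k := trig.frame.1
    rw [(new.running hs').2.2, trig.frame.2.2.1, new.frame.1, hk₂]
    congr 1
    ext τ
    simp only [Set.mem_ofPred_eq]
    omega

theorem Act.cuts_eq (ha : H.Act P par q j s s') (hk : s'.k = s.k + 1) :
    H.cuts s'.k = s'.model := by
  cases ha with
  | idle => exact absurd hk (Nat.succ_ne_self s.k).symm
  | generate s₂ _ trig new => rw [new.frame.1, new.cuts_eq, new.frame.2.2.1]

theorem Act.mem_model_of_protected (ha : H.Act P par q j s s') (hinc : s'.inc = s.inc)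
    {C : Cut n T} (hC : C ∈ insert (H.cut P q j) s.model) (hp : H.Protected P par s.k C) :
    C ∈ s'.model := by
  cases ha with
  | idle => exact hC
  | generate s₂ _ trig new =>
    obtain ⟨-, hinc', hmodel, -⟩ := new.frame
    exact hmodel ▸ (trig.of_inc_eq (hinc'.symm.trans hinc)).1 C hC hp

theorem Act.Δcurr_eq_or (ha : H.Act P par q j s s') (hinc : s'.inc = s.inc) :
    s'.Δcurr = s.Δcurr ∨ s'.Δcurr = (H.reduceΔ P q s.Δcurr s.counter).1 := by
  cases ha with
  | idle => exact Or.inl rfl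
  | generate s₂ _ trig new =>
    obtain ⟨-, hinc', -, hΔ⟩ := new.frame
    exact hΔ ▸ (trig.of_inc_eq (hinc'.symm.trans hinc)).2

end History

end Invariants

section Runs

variable {n m₁ n₂ m₂ N T : ℕ}

namespace History

variable (H : History n T) (P : TwoStageLP n m₁ n₂ m₂ N T) (par : Params)

/-- A part of a run during which the incumbent index is always `I` and the algorithm never stops.
The analysis of the algorithm takes place here: such a part is shown to have an optimal
incumbent. -/
structure QuietRun (u : ℕ → State n T) (I : Option ℕ) : Prop where
  inv : ∀ i, H.Invariant P par (u i)
  running : ∀ i, (u i).stopped = false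
  inc_eq : ∀ i, (u i).inc = I
  act : ∀ i, ∃ q j, (q, j) ∈ (u i).pool ∧ H.Act P par q j (u i) (u (i + 1))
  complete : TasksComplete u

variable {H P par} {s : State n T} {u : ℕ → State n T} {I : Option ℕ} {i i' k l q r : ℕ}
  {j : Fin T}

theorem exists_mul_le_gap (hP : P.Standing) (hr : H.x r ∈ P.feasible)
    (hS : H.x r ∉ P.solutionSet) :
    ∃ κ > 0, ∀ q, H.IterateSpec P q r → 0 < H.Δ q → min 1 (H.Δ q) * κ ≤ H.gap P r q := by
  obtain ⟨κ, hκ, hdec⟩ := hP.exists_decrease hr hS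
  refine ⟨κ, hκ, fun q hspec hΔ => ?_⟩
  obtain ⟨x, hx, hQ⟩ := hdec _ hΔ
  rw [gap]
  linarith [hspec.m_le_Q hx]

theorem Invariant.certificate (h : H.Invariant P par s) (hs : s.stopped = true)
    (htol : par.εtol = 0) (hr : s.inc = some r) :
    0 < H.Δ s.k ∧ (∀ x, P.model (H.cuts s.k) x ≤ (P.Q x : EReal)) ∧
      ∀ x ∈ P.trustRegion (H.x r) (H.Δ s.k), (P.Q (H.x r) : EReal) ≤ P.model (H.cuts s.k) x := by
  have hgap : H.gap P r s.k ≤ 0 := (convTest_some_iff htol).1 (hr ▸ h.convTest hs)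
  have hspec := h.iterateSpec s.k le_rfl r (h.parent_k.trans hr)
  refine ⟨h.Δ_pos _ le_rfl, TwoStageLP.model_le_Q hspec.under, fun x hx => ?_⟩
  calc (P.Q (H.x r) : EReal) ≤ H.m s.k := EReal.coe_le_coe_iff.2 (sub_nonpos.1 hgap)
    _ = P.model (H.cuts s.k) (H.x s.k) := hspec.m_eq
    _ ≤ P.model (H.cuts s.k) x := hspec.solves.2 x hx

theorem Invariant.optimal (h : H.Invariant P par s) (hP : P.Standing) (hs : s.stopped = true)
    (htol : par.εtol = 0) : ∃ r, s.inc = some r ∧ H.x r ∈ P.solutionSet := by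
  obtain ⟨r, hr, -⟩ := h.convTest hs
  refine ⟨r, hr, ?_⟩
  by_contra hS
  have hgap : H.gap P r s.k ≤ 0 := (convTest_some_iff htol).1 (hr ▸ h.convTest hs)
  have hΔ := h.Δ_pos s.k le_rfl
  obtain ⟨κ, hκ, hκ_le⟩ := exists_mul_le_gap hP (h.x_mem r (h.inc_le r hr)) hS
  exact (mul_pos (lt_min one_pos hΔ) hκ).not_ge
    ((hκ_le _ (h.iterateSpec _ le_rfl r (h.parent_k.trans hr)) hΔ).trans hgap)

/-- A poor ratio means that `Q` exceeds its value at the incumbent by a fixed amount, which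
continuity rules out close to the incumbent. -/
theorem exists_le_Δ_of_one_lt_ρ (hP : P.Standing) (hr : H.x r ∈ P.feasible)
    (hS : H.x r ∉ P.solutionSet) :
    ∃ ε > 0, ∀ q, H.IterateSpec P q r → 0 < H.Δ q → 0 < H.gap P r q → 1 < H.ρ P q r →
      ε ≤ H.Δ q := by
  obtain ⟨κ, hκ, hκ_le⟩ := exists_mul_le_gap hP hr hS
  obtain ⟨ε, hε, hcont⟩ := Metric.continuous_iff.1 hP.continuous_Q (H.x r) κ hκ
  refine ⟨ε, hε, fun q hspec hΔ hgap hρ => ?_⟩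
  by_contra! hlt
  have hclose : P.Q (H.x q) - P.Q (H.x r) < κ :=
    (le_abs_self _).trans_lt
      (hcont (H.x q) ((dist_eq_norm _ _).trans_lt (hspec.solves.1.2.trans_lt hlt)))
  have hρ' : H.gap P r q < min 1 (H.Δ q) * (P.Q (H.x q) - P.Q (H.x r)) := by
    rwa [ρ, ← mul_div_assoc, ← gap, one_lt_div hgap] at hρ
  exact ((hκ_le q hspec hΔ).trans_lt hρ').not_ge
    (mul_le_mul_of_nonneg_left hclose.le (lt_min one_pos hΔ).le)

namespace QuietRun

theorem waiting (h : H.QuietRun P par u I) (i : ℕ) : H.WaitingInvariant P par (u i) :=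
  (h.inv i).waiting (h.running i)

theorem k_mono (h : H.QuietRun P par u I) : Monotone fun i => (u i).k := by
  refine monotone_nat_of_le_succ fun i => ?_
  obtain ⟨q, j, -, ha⟩ := h.act i
  rcases ha.k_eq_or with hk | hk <;> omega

theorem notMem_pool (h : H.QuietRun P par u I) (hi : i ≤ i') (hq : q ≤ (u i).k)
    (hj : (q, j) ∉ (u i).pool) : (q, j) ∉ (u i').pool := by
  induction i', hi using Nat.le_induction with
  | base => exact hj
  | succ i' hi ih =>
    obtain ⟨q', j', -, ha⟩ := h.act i'
    rw [ha.pool_eq (h.running _)]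
    rintro (hm | hm)
    · exact ih hm.1
    · exact (hm.1.trans_le (hq.trans (h.k_mono hi))).false

theorem eventually_evaluated (h : H.QuietRun P par u I) (hq : q ≤ (u i).k) :
    ∀ᶠ i' in atTop, (u i').Evaluated q := by
  refine eventually_all.2 fun j => ?_
  obtain ⟨i', hi', hj⟩ : ∃ i' ≥ i, (q, j) ∉ (u i').pool := by
    by_cases hm : (q, j) ∈ (u i).pool
    · obtain ⟨i', hi', hst | hj⟩ := h.complete i _ hm
      · simp [h.running i'] at hst
      · exact ⟨i', hi', hj⟩
    · exact ⟨i, le_rfl, hm⟩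
  exact (eventually_ge_atTop i').mono fun a ha => h.notMem_pool ha (hq.trans (h.k_mono hi')) hj

theorem tendsto_k (h : H.QuietRun P par u I) : Tendsto (fun i => (u i).k) atTop atTop := by
  refine tendsto_atTop_atTop_of_monotone h.k_mono fun k => ?_
  induction k with
  | zero => exact ⟨0, Nat.zero_le _⟩
  | succ k ih =>
    obtain ⟨i, hi⟩ := ih
    obtain ⟨i', hev, hi'⟩ :=
      ((h.eventually_evaluated (le_refl (u i).k)).and (eventually_ge_atTop i)).exists
    have hne : (u i).k ≠ (u i').k := fun he => (h.waiting i').not_evaluated_k (he ▸ hev)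
    exact ⟨i', Nat.succ_le_of_lt (hi.trans_lt ((h.k_mono hi').lt_of_ne hne))⟩

theorem exists_generation (h : H.QuietRun P par u I) (hk : (u i).k ≤ k) :
    ∃ i' ≥ i, (u i').k = k ∧ (u (i' + 1)).k = k + 1 := by
  have hstep : ∀ a, (u (a + 1)).k ≤ (u a).k + 1 := by
    intro a
    obtain ⟨q, j, -, ha⟩ := h.act a
    rcases ha.k_eq_or with hk | hk <;> omega
  obtain ⟨i', hk', hi'⟩ := ((h.tendsto_k.eventually_gt_atTop k).and (eventually_ge_atTop i)).exists
  exact exists_eq_and_succ_eq (f := fun a => (u a).k) hstep hk hi' hk'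

theorem isSubgradient_Q (h : H.QuietRun P par u I) (l : ℕ) :
    IsSubgradient P.Q (H.x l) (P.c + ∑ j, H.g l j) := by
  obtain ⟨i, hi⟩ := (h.tendsto_k.eventually_ge_atTop l).exists
  obtain ⟨i', hev, hi'⟩ := ((h.eventually_evaluated hi).and (eventually_ge_atTop i)).exists
  exact TwoStageLP.isSubgradient_Q fun j =>
    (h.waiting i').isSubgradient l (hi.trans (h.k_mono hi')) j (hev j)

/-- The starting point has no parent incumbent, so once it has been evaluated it would replace
the dummy incumbent. -/
theorem inc_ne_none (h : H.QuietRun P par u I) (h₀ : H.parent 0 = none) : I ≠ none := by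
  rintro rfl
  obtain ⟨i, hev⟩ := (h.eventually_evaluated (Nat.zero_le (u 0).k)).exists
  refine (h.waiting i).not_accept 0 (Nat.zero_le _) hev ?_
  exact ⟨by simp [h.inc_eq i], by simp [h₀]⟩

theorem parent_eq (h : H.QuietRun P par u I) (hk : (u 0).k ≤ k) : H.parent k = I := by
  obtain ⟨i, -, rfl, -⟩ := h.exists_generation hk
  exact (h.inv i).parent_k.trans (h.inc_eq i)

theorem Δ_pos (h : H.QuietRun P par u I) (hk : (u 0).k ≤ k) : 0 < H.Δ k := by
  obtain ⟨i, -, rfl, -⟩ := h.exists_generation hk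
  exact (h.inv i).Δ_pos _ le_rfl

theorem Δ_antitoneOn (h : H.QuietRun P par u I) : AntitoneOn H.Δ (Set.Ici (u 0).k) := by
  refine antitoneOn_nat_Ici_of_succ_le fun k hk => ?_
  obtain ⟨i, -, rfl, hk'⟩ := h.exists_generation hk
  obtain ⟨q, j, -, ha⟩ := h.act i
  rw [← hk', (h.inv _).Δ_k, (h.inv _).Δ_k]
  rcases ha.Δcurr_eq_or ((h.inc_eq _).trans (h.inc_eq i).symm) with he | he
  exacts [he.le, he.le.trans (reduceΔ_le q _ _)]

theorem center_mem (h : H.QuietRun P par u (some r)) : H.x r ∈ P.feasible :=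
  (h.inv 0).x_mem r ((h.inv 0).inc_le r (h.inc_eq 0))

theorem iterateSpec (h : H.QuietRun P par u (some r)) (hk : (u 0).k ≤ k) :
    H.IterateSpec P k r := by
  have hp := h.parent_eq hk
  obtain ⟨i, -, rfl, -⟩ := h.exists_generation hk
  exact (h.inv i).iterateSpec _ le_rfl r hp

theorem x_mem_closedBall (h : H.QuietRun P par u (some r)) (hk : (u 0).k ≤ k) :
    H.x k ∈ Metric.closedBall (H.x r) (H.Δ (u 0).k) :=
  mem_closedBall_iff_norm.2
    ((h.iterateSpec hk).solves.1.2.trans (h.Δ_antitoneOn Set.self_mem_Ici hk hk))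

theorem gap_pos (h : H.QuietRun P par u (some r)) (htol : par.εtol = 0) (hk : (u 0).k ≤ k) :
    0 < H.gap P r k := by
  have hp := h.parent_eq hk
  obtain ⟨i, -, rfl, -⟩ := h.exists_generation hk
  have hconv := (h.waiting i).not_convTest _ le_rfl
  rwa [hp, convTest_some_iff htol, not_le] at hconv

/-- The active cuts alone determine the optimal value of a subproblem. Since they survive, and
the radius does not grow, the optimal values increase. -/
theorem gap_antitoneOn (h : H.QuietRun P par u (some r)) :
    AntitoneOn (H.gap P r) (Set.Ici (u 0).k) := by
  refine antitoneOn_nat_Ici_of_succ_le fun k hk => sub_le_sub_left ?_ _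
  have hspec := h.iterateSpec hk
  have hspec' : H.IterateSpec P (k + 1) r := h.iterateSpec (hk.trans k.le_succ)
  have hΔ : H.Δ (k + 1) ≤ H.Δ k := h.Δ_antitoneOn hk (hk.trans k.le_succ) k.le_succ
  have hactive : activeCuts (H.cuts k) (H.x k) ⊆ H.cuts (k + 1) := by
    obtain ⟨i, -, rfl, hk'⟩ := h.exists_generation hk
    obtain ⟨q, j, -, ha⟩ := h.act i
    intro C hC
    have hmodel : C ∈ (u i).model :=
      (h.inv i).cuts_subset (h.inc_eq i ▸ Option.some_ne_none r) hC.1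
    rw [← hk', ha.cuts_eq hk']
    exact ha.mem_model_of_protected ((h.inc_eq _).trans (h.inc_eq i).symm) (Or.inr hmodel)
      (Or.inr (Or.inl hC))
  rw [← EReal.coe_le_coe_iff, hspec.m_eq, hspec'.m_eq]
  calc P.model (H.cuts k) (H.x k)
      ≤ P.model (activeCuts (H.cuts k) (H.x k)) (H.x (k + 1)) :=
        TwoStageLP.model_le_model_activeCuts hspec.finite (TwoStageLP.convex_trustRegion _ _)
          hspec.solves.1 hspec.solves.2
          ⟨hspec'.solves.1.1, hspec'.solves.1.2.trans hΔ⟩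
    _ ≤ P.model (H.cuts (k + 1)) (H.x (k + 1)) := TwoStageLP.model_mono hactive _

theorem sub_lt_Q (h : H.QuietRun P par u (some r)) (htol : par.εtol = 0) (hl : (u 0).k ≤ l) :
    P.Q (H.x r) - par.ξ * H.gap P r l < P.Q (H.x l) := by
  have hgap := mul_pos par.ξ_pos (h.gap_pos htol hl)
  have hp := h.parent_eq hl
  obtain ⟨i, -, rfl, -⟩ := h.exists_generation hl
  obtain ⟨i', hev, hi'⟩ := ((h.eventually_evaluated le_rfl).and (eventually_ge_atTop i)).exists
  by_contra! hle
  refine (h.waiting i').not_accept _ (h.k_mono hi') hev ⟨fun r' hr' => ?_, fun r' hr' => ?_⟩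
  · obtain rfl : r = r' := Option.some.inj ((h.inc_eq i').symm.trans hr')
    linarith
  · obtain rfl : r = r' := Option.some.inj (hp.symm.trans hr')
    exact hle

theorem cut_mem_model (h : H.QuietRun P par u (some r)) (hl : (u 0).k < l)
    (hgap : ∀ k ≥ l, par.η * H.gap P r l < H.gap P r k) (i : ℕ) :
    l ≤ (u i).k → (l, j) ∉ (u i).pool → H.cut P l j ∈ (u i).model := by
  induction i with
  | zero => exact fun hlk => (hl.trans_le hlk).false.elim
  | succ i ih =>
    intro hlk hj
    obtain ⟨q', j', -, ha⟩ := h.act i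
    rw [ha.pool_eq (h.running _)] at hj
    have hli : l ≤ (u i).k := by
      by_contra! hlt
      exact hj (Or.inr ⟨hlt, hlk⟩)
    have hmem : H.cut P l j ∈ insert (H.cut P q' j') (u i).model := by
      by_cases he : (l, j) = (q', j')
      · obtain ⟨rfl, rfl⟩ := Prod.mk.inj he
        exact Set.mem_insert _ _
      · exact Or.inr (ih hli fun hm => hj (Or.inl ⟨hm, he⟩))
    have hparent : H.parent (u i).k = some r := (h.inv i).parent_k.trans (h.inc_eq i)
    exact ha.mem_model_of_protected ((h.inc_eq _).trans (h.inc_eq i).symm) hmem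
      (Or.inr (Or.inr ⟨r, l, hparent, rfl, h.parent_eq hl.le, hgap _ hli⟩))

theorem eventually_cut_mem_cuts (h : H.QuietRun P par u (some r)) (hl : (u 0).k < l)
    (hgap : ∀ k ≥ l, par.η * H.gap P r l < H.gap P r k) :
    ∀ᶠ k in atTop, ∀ j, H.cut P l j ∈ H.cuts k := by
  obtain ⟨i, hi⟩ := (h.tendsto_k.eventually_ge_atTop l).exists
  obtain ⟨i₁, hev, hi₁⟩ := ((h.eventually_evaluated hi).and (eventually_ge_atTop i)).exists
  have hl₁ : l ≤ (u i₁).k := hi.trans (h.k_mono hi₁)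
  filter_upwards [eventually_gt_atTop (u i₁).k] with k hk j
  obtain ⟨k, rfl⟩ := Nat.exists_eq_succ_of_ne_zero (Nat.ne_zero_of_lt hk)
  obtain ⟨a, ha, rfl, hk'⟩ := h.exists_generation (Nat.le_of_lt_succ hk)
  obtain ⟨q, j', -, hact⟩ := h.act a
  have hle : i₁ ≤ a + 1 := Nat.le_succ_of_le ha
  rw [Nat.succ_eq_add_one, ← hk', hact.cuts_eq hk']
  exact h.cut_mem_model hl hgap _ (hl₁.trans (h.k_mono hle)) (h.notMem_pool hle hl₁ (hev j))

theorem exists_tendsto_gap (h : H.QuietRun P par u (some r)) (htol : par.εtol = 0) :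
    ∃ γ ≥ 0, Tendsto (H.gap P r) atTop (𝓝 γ) := by
  have hanti : Antitone fun k => H.gap P r (k + (u 0).k) :=
    antitone_add_nat_iff_antitoneOn_nat_Ici.2 h.gap_antitoneOn
  have hnonneg : ∀ k, 0 ≤ H.gap P r (k + (u 0).k) := fun k =>
    (h.gap_pos htol (Nat.le_add_left _ k)).le
  exact ⟨_, le_ciInf hnonneg, (tendsto_add_atTop_iff_nat _).1
    (tendsto_atTop_ciInf hanti ⟨0, Set.forall_mem_range.2 hnonneg⟩)⟩

theorem gap_lt_of_cut_mem_cuts (h : H.QuietRun P par u (some r)) (htol : par.εtol = 0)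
    (hl : (u 0).k ≤ l) (hk : (u 0).k ≤ k) (hcuts : ∀ j, H.cut P l j ∈ H.cuts k) {δ : ℝ}
    (hδ : (P.c + ∑ j, H.g l j) ⬝ᵥ (H.x l - H.x k) < δ) :
    H.gap P r k < par.ξ * H.gap P r l + δ := by
  have hlow : P.Q (H.x l) + (P.c + ∑ j, H.g l j) ⬝ᵥ (H.x k - H.x l) ≤ H.m k := by
    rw [← EReal.coe_le_coe_iff, (h.iterateSpec hk).m_eq]
    exact Q_add_le_model hcuts _
  have hrej := h.sub_lt_Q htol hl
  rw [← neg_sub, dotProduct_neg] at hδ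
  rw [gap]
  linarith

/-- If the gaps had a positive limit, then the cuts of all late iterates would be kept. Take late
iterates `x^l`, `x^k` close to each other, with `k` much later than `l`. The cuts of `x^l` force
`m^k` almost up to `Q(x^l)`, and `x^l` has failed the acceptance test, so `m^k` would be too
large. -/
theorem gap_tendsto_zero (h : H.QuietRun P par u (some r)) (htol : par.εtol = 0)
    (hP : P.Standing) : Tendsto (H.gap P r) atTop (𝓝 0) := by
  obtain ⟨γ, hγ, hlim⟩ := h.exists_tendsto_gap htol
  rcases hγ.eq_or_lt with rfl | hγ
  · exact hlim
  exfalso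
  have hμ : max par.η par.ξ < 1 := max_lt par.η_lt (by linarith [par.ξ_lt])
  obtain ⟨δ, hδ, K, hK⟩ := exists_mul_add_le_of_tendsto hlim hγ hμ
  obtain ⟨D, hD, hDg⟩ := exists_dotProduct_le_of_isSubgradient hP.continuous_Q
    (isCompact_closedBall (H.x r) (H.Δ (u 0).k))
  obtain ⟨l, hl, hfreq⟩ := exists_frequently_dist_lt
    (isCompact_closedBall (H.x r) (H.Δ (u 0).k))
    ((eventually_ge_atTop (u 0).k).mono fun _ => h.x_mem_closedBall) (div_pos hδ hD)
    (max K ((u 0).k + 1))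
  obtain ⟨hKl, hl₀⟩ := max_le_iff.1 hl
  have hmul {a : ℝ} (ha : a ≤ max par.η par.ξ) {k : ℕ} (hk : K ≤ k) :
      a * H.gap P r l + δ ≤ H.gap P r k :=
    (add_le_add_left (mul_le_mul_of_nonneg_right ha
      (h.gap_pos htol (Nat.le_of_succ_le hl₀)).le) δ).trans (hK k hk l hKl)
  have hcuts := h.eventually_cut_mem_cuts hl₀ fun k hk =>
    (lt_add_of_pos_right _ hδ).trans_le (hmul (le_max_left _ _) (hKl.trans hk))
  obtain ⟨k, hdist, hcuts, hkl⟩ :=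
    (hfreq.and_eventually (hcuts.and (eventually_ge_atTop l))).exists
  have hk₀ : (u 0).k ≤ k := (Nat.le_of_succ_le hl₀).trans hkl
  have hvar : (P.c + ∑ j, H.g l j) ⬝ᵥ (H.x l - H.x k) < δ := by
    refine (hDg _ (h.x_mem_closedBall (Nat.le_of_succ_le hl₀)) _
      (h.isSubgradient_Q l) _).trans_lt ?_
    rwa [mul_comm, ← lt_div_iff₀ hD, ← dist_eq_norm, dist_comm]
  exact (h.gap_lt_of_cut_mem_cuts htol (Nat.le_of_succ_le hl₀) hk₀ hcuts hvar).not_ge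
    (hmul (le_max_right _ _) (hKl.trans hkl))

theorem exists_Δ_lower_bound (h : H.QuietRun P par u (some r)) (htol : par.εtol = 0)
    (hP : P.Standing) (hS : H.x r ∉ P.solutionSet) : ∃ δ > 0, ∀ k ≥ (u 0).k, δ ≤ H.Δ k := by
  obtain ⟨ε, hε, hεΔ⟩ := exists_le_Δ_of_one_lt_ρ hP h.center_mem hS
  obtain ⟨q₀, hq₀, hmin⟩ := Set.exists_min_image (Set.Iic (u 0).k) H.Δ (Set.finite_Iic _)
    Set.nonempty_Iic
  have hΔ₀ : 0 < H.Δ q₀ := (h.inv 0).Δ_pos q₀ hq₀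
  have hbound : ∀ i, min (H.Δ q₀) ε / 4 ≤ (u i).Δcurr := by
    intro i
    induction i with
    | zero =>
      rw [← (h.inv 0).Δ_k]
      linarith [min_le_left (H.Δ q₀) ε, hmin _ (Set.mem_Iic.2 (le_refl (u 0).k))]
    | succ i ih =>
      obtain ⟨q, j, hqj, ha⟩ := h.act i
      have hqΔ : 0 < H.Δ q := (h.inv i).Δ_pos q ((h.waiting i).pool_le _ hqj)
      rcases ha.Δcurr_eq_or ((h.inc_eq _).trans (h.inc_eq i).symm) with he | he
      · exact he ▸ ih
      rcases reduceΔ_eq_or_le (P := P) (Δcurr := (u i).Δcurr) (counter := (u i).counter) hqΔ with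
        hred | ⟨r', hr', hρ, hred⟩
      · exact he ▸ hred.symm ▸ ih
      · refine he ▸ (le_min ih ?_).trans hred
        gcongr
        rcases le_total q (u 0).k with hq | hq
        · exact (min_le_left _ _).trans (hmin q hq)
        · obtain rfl : r = r' := Option.some.inj ((h.parent_eq hq).symm.trans hr')
          exact (min_le_right _ _).trans (hεΔ q (h.iterateSpec hq) hqΔ (h.gap_pos htol hq) hρ)
  refine ⟨min (H.Δ q₀) ε / 4, by positivity, fun k hk => ?_⟩
  obtain ⟨i, -, rfl, -⟩ := h.exists_generation hk
  exact (h.inv i).Δ_k ▸ hbound i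

/-- A descent direction at a nonoptimal center would keep the gaps above a multiple of the radii,
which are bounded away from zero. -/
theorem center_optimal (h : H.QuietRun P par u (some r)) (htol : par.εtol = 0)
    (hP : P.Standing) : H.x r ∈ P.solutionSet := by
  by_contra hS
  obtain ⟨δ, hδ, hΔ⟩ := h.exists_Δ_lower_bound htol hP hS
  obtain ⟨κ, hκ, hκ_le⟩ := exists_mul_le_gap hP h.center_mem hS
  have hpos : 0 < min 1 δ * κ := mul_pos (lt_min one_pos hδ) hκ
  obtain ⟨k, hgap, hk⟩ := (((h.gap_tendsto_zero htol hP).eventually_lt_const hpos).and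
    (eventually_ge_atTop (u 0).k)).exists
  refine hgap.not_ge (le_trans ?_ (hκ_le k (h.iterateSpec hk) (h.Δ_pos hk)))
  gcongr
  exact hΔ k hk

end QuietRun

namespace IsRun

theorem invariant (hrun : H.IsRun P par u) (i : ℕ) : H.Invariant P par (u i) := by
  induction i with
  | zero =>
    obtain ⟨-, j, -⟩ := hrun.step 0 hrun.init.stopped
    exact hrun.init.invariant j.pos
  | succ i ih =>
    cases hs : (u i).stopped with
    | true => exact hrun.halt i hs ▸ ih
    | false =>
      obtain ⟨q, j, hqj, hg, ha⟩ := hrun.step i hs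
      exact ih.act hs hqj hg ha

theorem inc_succ_eq_or (hrun : H.IsRun P par u) (i : ℕ) :
    (u (i + 1)).inc = (u i).inc ∨
      ∃ q ≤ (u i).k, (u (i + 1)).inc = some q ∧ H.Accept P par (u i).inc q := by
  cases hs : (u i).stopped with
  | true => exact Or.inl (by rw [hrun.halt i hs])
  | false =>
    obtain ⟨q, j, hqj, -, ha⟩ := hrun.step i hs
    exact ha.inc_eq_or.imp_right fun hq =>
      ⟨q, ((hrun.invariant i).waiting hs).pool_le _ hqj, hq⟩

theorem stopped_or_quietRun (hrun : H.IsRun P par u) (hfin : TasksComplete u)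
    (hinc : ∀ i' ≥ i, (u i').inc = I) :
    (∃ i' ≥ i, (u i').stopped = true) ∨ H.QuietRun P par (fun a => u (i + a)) I := by
  refine or_iff_not_imp_left.2 fun hs => ?_
  push Not at hs
  have hs' (a : ℕ) : (u (i + a)).stopped = false :=
    Bool.eq_false_iff.2 (hs _ (Nat.le_add_right i a))
  refine ⟨fun a => hrun.invariant _, hs', fun a => hinc _ (Nat.le_add_right i a), fun a => ?_,
    fun a τ hτ => ?_⟩
  · obtain ⟨q, j, hqj, -, ha⟩ := hrun.step (i + a) (hs' a)
    exact ⟨q, j, hqj, ha⟩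
  · obtain ⟨i', hi', hc⟩ := hfin (i + a) τ hτ
    obtain ⟨b, rfl⟩ := Nat.exists_eq_add_of_le (le_of_add_le_left hi')
    exact ⟨b, Nat.le_of_add_le_add_left hi', hc⟩

theorem inc_eq_of_optimal (hrun : H.IsRun P par u) (hi : i ≤ i') (hr : (u i).inc = some r)
    (hS : H.x r ∈ P.solutionSet) : (u i').inc = some r := by
  induction i', hi using Nat.le_induction with
  | base => exact hr
  | succ i' _ ih =>
    rcases hrun.inc_succ_eq_or i' with he | ⟨q, hq, -, hacc⟩
    · exact he.trans ih
    · exact ((hS.2 _ ((hrun.invariant i').x_mem q hq)).not_gt (hacc.1 r ih)).elim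

theorem exists_new_inc (hrun : H.IsRun P par u) (hP : P.Standing) (htol : par.εtol = 0)
    (hfin : TasksComplete u) (hS : H.point (u i).inc ∉ P.solutionSet) :
    ∃ i' > i, ∃ r', (u i').inc = some r' ∧ (u i).inc ≠ some r' := by
  by_contra! hall
  have hinc : ∀ i' ≥ i, (u i').inc = (u i).inc := by
    intro i' hi'
    induction i', hi' using Nat.le_induction with
    | base => rfl
    | succ i' hi' ih =>
      rcases hrun.inc_succ_eq_or i' with he | ⟨q, -, he, -⟩
      · exact he.trans ih
      · exact he.trans (hall (i' + 1) (Nat.lt_succ_of_le hi') q he).symm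
  refine hS ?_
  rcases hrun.stopped_or_quietRun hfin hinc with ⟨i', hi', hst⟩ | hquiet
  · obtain ⟨r, hr, hopt⟩ := (hrun.invariant i').optimal hP hst htol
    rwa [← hinc i' hi', hr]
  · obtain ⟨r, hr⟩ := Option.ne_none_iff_exists'.1 (hquiet.inc_ne_none hrun.init.parent_zero)
    rw [hr] at hquiet ⊢
    exact hquiet.center_optimal htol hP

end IsRun

end History

end Runs

end ATR

theorem mainTheorem4 {n m₁ n₂ m₂ N T : ℕ} (P : ATR.TwoStageLP n m₁ n₂ m₂ N T)
    (hP : P.Standing) (par : ATR.Params) (htol : par.εtol = 0)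
    (H : ATR.History n T) (s : ℕ → ATR.State n T)
    (hrun : H.IsRun P par s) (hfin : ATR.TasksComplete s) :
    -- (i) a non-optimal incumbent is replaced by a new one after finitely many events
    (∀ i, H.point (s i).inc ∉ P.solutionSet →
      ∃ i' > i, ∃ r', (s i').inc = some r' ∧ (s i).inc ≠ some r') ∧
    -- (ii) an optimal incumbent: termination with a certificate, or the gap decreases to zero
    (∀ i r, (s i).inc = some r → H.x r ∈ P.solutionSet →
      (∃ i', (s i').stopped = true ∧ (s i').inc = some r ∧
        0 < H.Δ (s i').k ∧
        (∀ x, P.model (H.cuts (s i').k) x ≤ (P.Q x : EReal)) ∧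
        ∀ x ∈ P.trustRegion (H.x r) (H.Δ (s i').k),
          (P.Q (H.x r) : EReal) ≤ P.model (H.cuts (s i').k) x) ∨
      ((∀ k, ∃ i', k ≤ (s i').k) ∧
        (∀ k ≥ (s i).k, H.parent k = some r) ∧
        AntitoneOn (fun k => P.Q (H.x r) - H.m k) (Set.Ici (s i).k) ∧
        Filter.Tendsto (fun k => P.Q (H.x r) - H.m k) Filter.atTop (nhds 0))) ∧
    -- termination occurs at an optimal incumbent only
    (∀ i, (s i).stopped = true → ∃ r, (s i).inc = some r ∧ H.x r ∈ P.solutionSet) := by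
  refine ⟨fun i hS => hrun.exists_new_inc hP htol hfin hS, fun i r hr hS => ?_,
    fun i hs => (hrun.invariant i).optimal hP hs htol⟩
  have hinc : ∀ i' ≥ i, (s i').inc = some r := fun i' hi' => hrun.inc_eq_of_optimal hi' hr hS
  rcases hrun.stopped_or_quietRun hfin hinc with ⟨i', hi', hst⟩ | hquiet
  · exact Or.inl ⟨i', hst, hinc i' hi', (hrun.invariant i').certificate hst htol (hinc i' hi')⟩
  · refine Or.inr ⟨fun k => ?_, fun k hk => hquiet.parent_eq hk, hquiet.gap_antitoneOn,
      hquiet.gap_tendsto_zero htol hP⟩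
    obtain ⟨a, ha⟩ := (hquiet.tendsto_k.eventually_ge_atTop k).exists
    exact ⟨i + a, ha⟩
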